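/- For positive integers $\ell,k$ let the Ramsey number $R(\ell,k)$ be the smallest integer $n$ such that every colouring of the edges of the complete graph $K_n$ with the colours red and blue contains a copy of $K_\ell$ all of whose edges are red or a copy of $K_k$ all of whose edges are blue. Let $C>1$ be a real number. Then the equation $C=\frac{\log p}{\log(1-p)}$ has a unique solution $p_C$ in $(0,1/2)$, and there is a constant $\varepsilon>0$, depending only on $C$, such that for all sufficiently large positive integers $\ell$, $$R(\ell,\lfloor C\ell\rfloor)\ \ge\ \bigl(p_C^{-1/2}+\varepsilon\bigr)^{\ell}.$$ (Since $R(\ell,k)$ is non-decreasing in $k$, the same bound holds with $\lceil C\ell\rceil$ in place of $\lfloor C\ell\rfloor$.) -/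

import Mathlib

/-- `RamseyProperty ℓ k n`: every colouring of the edges of the complete graph on `n` vertices
with the colours red and blue contains a red copy of `K_ℓ` or a blue copy of `K_k`.
A colouring is given by the graph `G` of its red edges; the blue edges form the complement `Gᶜ`. -/
def RamseyProperty (ℓ k n : ℕ) : Prop :=
  ∀ G : SimpleGraph (Fin n), ¬ G.CliqueFree ℓ ∨ ¬ Gᶜ.CliqueFree k

/-- The Ramsey number `R(ℓ, k)`: the smallest `n` such that every red/blue edge-colouring of the
complete graph on `n` vertices contains a red `K_ℓ` or a blue `K_k`. (If no such `n` existed, this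
infimum would be `0`, so a positive lower bound for it is never due to that convention.) -/
noncomputable def ramseyNumber (ℓ k : ℕ) : ℕ :=
  sInf {n : ℕ | RamseyProperty ℓ k n}

/-!
The uniform random colouring with red density `p` gives the bound `p ^ (-ℓ / 2)`, up to
subexponential factors, when the red and the blue first moment conditions agree, that is when
`log p = C * log (1 - p)`. It is improved exponentially by a random geometric colouring. Each vertex
`u` gets a uniformly random sign vector `x u` in `{-1, 1} ^ d`, where `d = m ^ 2` and `m`
is about `s * ℓ / τ` for small constants `s` and `τ`, and `u v` is blue with probability
`min 1 ((1 - p) * exp (r * s * ⟨x u, x v⟩ / m))`, where `r = p / (1 - p)`, independently for all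
pairs given the vectors. So red edges prefer negatively correlated vectors, and the red density on
a pair is close to `p * exp (-s * ⟨x u, x v⟩ / m)`. The pairwise second-order effects of this tilt
are compensated by a small change of `p`. What remains is a third-order effect: the expected product
of the three correlations in a triangle is positive, so red triangles become rarer by a
factor `1 - s ^ 3 / m`, and blue ones more frequent by a factor `1 + r ^ 3 * s ^ 3 / m`. Over a
clique on `ℓ`, respectively `k ≈ C * ℓ`, vertices this amounts to a red gain of `exp (s² τ ℓ² / 6)`
and a blue loss of `exp (r ^ 3 * C * s² τ k² / 6)`. Since `C * p ^ 2 < (1 - p) ^ 2` at the balanced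
density (`exists_balanced_density`), the gain outweighs the loss once a change of `p` of the same
order distributes the difference between the two colours.

The blue probability is bounded by the exponential tilt itself, for which the expectation factorises
over the `d` coordinates into exponential moments of a quadratic form in signs (`expect_blue_le`).
The red probability is not an exponential. By the pointwise inequality `one_le_red_add_blue` it is
at most `p * exp (-u) * (1 - lam + lam * cos (u / c))` with `u` proportional to the correlation. The
cosine is a mixture of characters, so again everything factorises over the coordinates, now with
complex exponents `redExponent` that depend on a random matrix with entries in `{-1, 0, 1}`.
The moment expansion `norm_expect_redExponent_le` of a single coordinate, with fourth moments
controlled by hypercontractivity, exhibits the triangle term, and the exceptional matrices are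
removed by exponential moments (`sum_mixWeight_norm_le`). This gives `expect_red_le_exp`. The first
moment method `not_ramseyProperty_of_types` then yields `exists_not_ramseyProperty`.
-/

namespace RamseyLower

open Finset

open scoped BigOperators

/-! ### Linear and quadratic forms in signs -/

/-- The sign `1` or `-1` encoded by a Boolean. -/
def sgn (b : Bool) : ℝ := if b then 1 else -1

@[simp] lemma sgn_true : sgn true = 1 := rfl
@[simp] lemma sgn_false : sgn false = -1 := rfl

/-- The linear form `∑ lᵢ yᵢ` in the signs `y`. -/
def linForm {n : ℕ} (l : Fin n → ℝ) (y : Fin n → Bool) : ℝ := ∑ i, l i * sgn (y i)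

/-- The sum of `w i j` over the pairs `i < j`. -/
def pairSum {n : ℕ} (w : Fin n → Fin n → ℝ) : ℝ := ∑ i, ∑ j, if i < j then w i j else 0

/-- The multilinear quadratic form `∑_{i<j} wᵢⱼ yᵢ yⱼ` in the signs `y`; only the entries of `w`
above the diagonal matter. -/
def quadForm {n : ℕ} (w : Fin n → Fin n → ℝ) (y : Fin n → Bool) : ℝ :=
  pairSum fun i j => w i j * (sgn (y i) * sgn (y j))

/-- The total weight `∑_{j ≠ i} w_{ij}` at the vertex `i`, where `w` is read above the diagonal. -/
def vertexSum {n : ℕ} (w : Fin n → Fin n → ℝ) (i : Fin n) : ℝ :=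
  ∑ j, if i < j then w i j else if j < i then w j i else 0

/-- Averaging over `n + 1` signs means averaging over the first one, then over the others. -/
lemma expect_cons {n : ℕ} (f : (Fin (n + 1) → Bool) → ℝ) :
    𝔼 y, f y = 𝔼 y : Fin n → Bool, (f (Fin.cons true y) + f (Fin.cons false y)) / 2 := by
  rw [Fintype.expect_eq_sum_div_card, Fintype.expect_eq_sum_div_card,
    ← (Fin.consEquiv fun _ : Fin (n + 1) => Bool).sum_comp, Fintype.sum_prod_type]
  simp only [Fintype.sum_bool, Fin.consEquiv, Equiv.coe_fn_mk, ← Finset.sum_div,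
    Finset.sum_add_distrib]
  simp [pow_succ]
  field_simp

lemma expect_add_const {n : ℕ} (f : (Fin n → Bool) → ℝ) (c : ℝ) :
    𝔼 y, (f y + c) = 𝔼 y, f y + c := by
  rw [expect_add_distrib, Fintype.expect_const]

lemma pairSum_succ {n : ℕ} (w : Fin (n + 1) → Fin (n + 1) → ℝ) :
    pairSum w = ∑ j : Fin n, w 0 j.succ + pairSum fun i j => w i.succ j.succ := by
  simp [pairSum, Fin.sum_univ_succ]

lemma linForm_cons {n : ℕ} (l : Fin (n + 1) → ℝ) (b : Bool) (y : Fin n → Bool) :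
    linForm l (Fin.cons b y) = l 0 * sgn b + linForm (fun i => l i.succ) y := by
  simp [linForm, Fin.sum_univ_succ]

lemma quadForm_cons {n : ℕ} (w : Fin (n + 1) → Fin (n + 1) → ℝ) (b : Bool) (y : Fin n → Bool) :
    quadForm w (Fin.cons b y) = sgn b * linForm (fun j => w 0 j.succ) y
      + quadForm (fun i j => w i.succ j.succ) y := by
  simp only [quadForm, pairSum_succ, Fin.cons_zero, Fin.cons_succ, linForm, Finset.mul_sum]
  congr 1
  exact Finset.sum_congr rfl fun _ _ => by ring

lemma vertexSum_zero {n : ℕ} (w : Fin (n + 1) → Fin (n + 1) → ℝ) :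
    vertexSum w 0 = ∑ j : Fin n, w 0 j.succ := by
  simp [vertexSum, Fin.sum_univ_succ]

lemma vertexSum_succ {n : ℕ} (w : Fin (n + 1) → Fin (n + 1) → ℝ) (i : Fin n) :
    vertexSum w i.succ = w 0 i.succ + vertexSum (fun i j => w i.succ j.succ) i := by
  simp [vertexSum, Fin.sum_univ_succ]

lemma pairSum_const {n : ℕ} (a : ℝ) :
    pairSum (fun _ _ : Fin n => a) = a * (n * (n - 1) / 2) := by
  induction n with
  | zero => simp [pairSum]
  | succ n ih => rw [pairSum_succ, ih]; simp; ring

lemma pairSum_nonneg {n : ℕ} {w : Fin n → Fin n → ℝ} (h : ∀ i j, 0 ≤ w i j) : 0 ≤ pairSum w :=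
  Finset.sum_nonneg fun i _ => Finset.sum_nonneg fun j _ => by
    split_ifs
    exacts [h i j, le_rfl]

lemma pairSum_mul {n : ℕ} (a : ℝ) (w : Fin n → Fin n → ℝ) :
    pairSum (fun i j => a * w i j) = a * pairSum w := by
  simp [pairSum, Finset.mul_sum, mul_ite]

/-! ### Moments of linear and quadratic forms in random signs -/

lemma expect_linForm_mul {n : ℕ} (l l' : Fin n → ℝ) :
    𝔼 y, linForm l y * linForm l' y = ∑ i, l i * l' i := by
  induction n with
  | zero => simp [linForm]
  | succ n ih =>
    rw [expect_cons, Fin.sum_univ_succ, ← ih fun i => l i.succ,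
      ← Fintype.expect_const (ι := Fin n → Bool) (l 0 * l' 0), ← expect_add_distrib]
    refine expect_congr rfl fun y _ => ?_
    simp only [linForm_cons, sgn_true, sgn_false]; ring

lemma expect_linForm_sq {n : ℕ} (l : Fin n → ℝ) : 𝔼 y, linForm l y ^ 2 = ∑ i, l i ^ 2 := by
  simpa only [sq] using expect_linForm_mul l l

lemma expect_quadForm {n : ℕ} (w : Fin n → Fin n → ℝ) : 𝔼 y, quadForm w y = 0 := by
  induction n with
  | zero => simp [quadForm, pairSum]
  | succ n ih =>
    rw [expect_cons, ← ih fun i j => w i.succ j.succ]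
    refine expect_congr rfl fun y _ => ?_
    simp only [quadForm_cons, sgn_true, sgn_false]; ring

lemma expect_quadForm_sq {n : ℕ} (w : Fin n → Fin n → ℝ) :
    𝔼 y, quadForm w y ^ 2 = pairSum fun i j => w i j ^ 2 := by
  induction n with
  | zero => simp [quadForm, pairSum]
  | succ n ih =>
    rw [expect_cons, pairSum_succ, ← ih fun i j => w i.succ j.succ, ← expect_linForm_sq,
      ← expect_add_distrib]
    refine expect_congr rfl fun y _ => ?_
    simp only [quadForm_cons, sgn_true, sgn_false]; ring

lemma expect_linForm_pow_four_le {n : ℕ} (l : Fin n → ℝ) :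
    𝔼 y, linForm l y ^ 4 ≤ 3 * (∑ i, l i ^ 2) ^ 2 := by
  induction n with
  | zero => simp [linForm]
  | succ n ih =>
    have h : 𝔼 y, linForm l y ^ 4 = 𝔼 y, linForm (fun i => l i.succ) y ^ 4
        + 6 * l 0 ^ 2 * 𝔼 y, linForm (fun i => l i.succ) y ^ 2 + l 0 ^ 4 := by
      rw [expect_cons, mul_expect, ← expect_add_distrib, ← expect_add_const]
      refine expect_congr rfl fun y _ => ?_
      simp only [linForm_cons, sgn_true, sgn_false]; ring
    rw [h, expect_linForm_sq, Fin.sum_univ_succ]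
    have := ih fun i => l i.succ
    nlinarith [sq_nonneg (l 0 ^ 2)]

lemma expect_mul_sq_le {Ω : Type*} [Fintype Ω] (f g : Ω → ℝ) :
    (𝔼 y, f y * g y) ^ 2 ≤ (𝔼 y, f y ^ 2) * 𝔼 y, g y ^ 2 := by
  simp only [Fintype.expect_eq_sum_div_card]
  rw [div_pow, div_mul_div_comm, ← sq]
  gcongr
  exact sum_mul_sq_le_sq_mul_sq _ _ _

/-- Bonami's hypercontractive inequality for quadratic forms in signs. -/
lemma expect_quadForm_pow_four_le {n : ℕ} (w : Fin n → Fin n → ℝ) :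
    𝔼 y, quadForm w y ^ 4 ≤ 81 * (pairSum fun i j => w i j ^ 2) ^ 2 := by
  induction n with
  | zero => simp [quadForm, pairSum]
  | succ n ih =>
    set L := linForm fun j : Fin n => w 0 j.succ
    set Q := quadForm fun i j : Fin n => w i.succ j.succ
    have h : 𝔼 y, quadForm w y ^ 4 = 𝔼 y, Q y ^ 4 + 6 * 𝔼 y, Q y ^ 2 * L y ^ 2
        + 𝔼 y, L y ^ 4 := by
      rw [expect_cons, mul_expect, ← expect_add_distrib, ← expect_add_distrib]
      refine expect_congr rfl fun y _ => ?_
      simp only [quadForm_cons, sgn_true, sgn_false]; ring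
    have hQ := ih fun i j => w i.succ j.succ
    have hL := expect_linForm_pow_four_le fun j : Fin n => w 0 j.succ
    have hcs := expect_mul_sq_le (fun y => Q y ^ 2) fun y => L y ^ 2
    simp only [← pow_mul, Nat.reduceMul] at hcs
    rw [h, pairSum_succ]
    set q := pairSum fun i j : Fin n => w i.succ j.succ ^ 2
    set s := ∑ j : Fin n, w 0 j.succ ^ 2
    have hq : 0 ≤ q := pairSum_nonneg fun i j => sq_nonneg _
    have hs : 0 ≤ s := Finset.sum_nonneg fun i _ => sq_nonneg _
    have hQ0 : 0 ≤ 𝔼 y, Q y ^ 4 := expect_nonneg fun y _ => by positivity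
    have hL0 : 0 ≤ 𝔼 y, L y ^ 4 := expect_nonneg fun y _ => by positivity
    have hx : 𝔼 y, Q y ^ 2 * L y ^ 2 ≤ 27 * (q * s) := by
      apply le_of_sq_le_sq _ (by positivity)
      calc _ ≤ _ := hcs
        _ ≤ (81 * q ^ 2) * (3 * s ^ 2) := mul_le_mul hQ hL hL0 (by positivity)
        _ ≤ _ := by nlinarith [mul_nonneg (sq_nonneg q) (sq_nonneg s)]
    nlinarith [mul_nonneg hq hs, sq_nonneg s]

lemma quadForm_one {n : ℕ} (y : Fin n → Bool) :
    quadForm (fun _ _ => 1) y = (linForm (fun _ => 1) y ^ 2 - n) / 2 := by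
  induction n with
  | zero => simp [quadForm, linForm, pairSum]
  | succ n ih =>
    induction y using Fin.consCases with
    | cons b y =>
      rw [quadForm_cons, ih, linForm_cons]
      cases b <;> push_cast [sgn_true, sgn_false] <;> ring

lemma expect_sum_pow_four (n : ℕ) :
    𝔼 y : Fin n → Bool, linForm (fun _ => 1) y ^ 4 = 3 * (n : ℝ) ^ 2 - 2 * n := by
  induction n with
  | zero => simp [linForm]
  | succ n ih =>
    have h : 𝔼 y : Fin (n + 1) → Bool, linForm (fun _ => 1) y ^ 4
        = 𝔼 y : Fin n → Bool, linForm (fun _ => 1) y ^ 4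
        + 6 * 𝔼 y : Fin n → Bool, linForm (fun _ => 1) y ^ 2 + 1 := by
      rw [expect_cons, mul_expect, ← expect_add_distrib, ← expect_add_const]
      refine expect_congr rfl fun y _ => ?_
      simp only [linForm_cons, sgn_true, sgn_false]; ring
    rw [h, ih, expect_linForm_sq]; simp; ring

lemma expect_sum_pow_six (n : ℕ) :
    𝔼 y : Fin n → Bool, linForm (fun _ => 1) y ^ 6
      = 15 * (n : ℝ) ^ 3 - 30 * (n : ℝ) ^ 2 + 16 * n := by
  induction n with
  | zero => simp [linForm]
  | succ n ih =>
    have h : 𝔼 y : Fin (n + 1) → Bool, linForm (fun _ => 1) y ^ 6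
        = 𝔼 y : Fin n → Bool, linForm (fun _ => 1) y ^ 6
        + 15 * 𝔼 y : Fin n → Bool, linForm (fun _ => 1) y ^ 4
        + 15 * 𝔼 y : Fin n → Bool, linForm (fun _ => 1) y ^ 2 + 1 := by
      rw [expect_cons, mul_expect, mul_expect, ← expect_add_distrib, ← expect_add_distrib,
        ← expect_add_const]
      refine expect_congr rfl fun y _ => ?_
      simp only [linForm_cons, sgn_true, sgn_false]; ring
    rw [h, ih, expect_linForm_sq, expect_sum_pow_four]; simp; ring

/-- The third moment counts ordered triangles. -/
lemma expect_quadForm_one_cube (n : ℕ) :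
    𝔼 y : Fin n → Bool, quadForm (fun _ _ => 1) y ^ 3 = (n : ℝ) ^ 3 - 3 * (n : ℝ) ^ 2 + 2 * n := by
  have h : 𝔼 y : Fin n → Bool, quadForm (fun _ _ => 1) y ^ 3
      = (1 / 8) * 𝔼 y : Fin n → Bool, linForm (fun _ => 1) y ^ 6
      + (-3 * n / 8) * 𝔼 y : Fin n → Bool, linForm (fun _ => 1) y ^ 4
      + (3 * n ^ 2 / 8) * 𝔼 y : Fin n → Bool, linForm (fun _ => 1) y ^ 2 + (- n ^ 3 / 8) := by
    rw [mul_expect, mul_expect, mul_expect,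
      ← expect_add_distrib, ← expect_add_distrib, ← expect_add_const]
    refine expect_congr rfl fun y _ => ?_
    rw [quadForm_one]; ring
  rw [h, expect_sum_pow_six, expect_sum_pow_four, expect_linForm_sq]; simp; ring

lemma expect_quadForm_mul_linForm_mul_sum {n : ℕ} (w : Fin n → Fin n → ℝ) (l : Fin n → ℝ) :
    𝔼 y, quadForm w y * linForm l y * linForm (fun _ => 1) y = ∑ i, l i * vertexSum w i := by
  induction n with
  | zero => simp [linForm]
  | succ n ih =>
    set u := fun j : Fin n => w 0 j.succ
    set w' := fun i j : Fin n => w i.succ j.succ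
    set l' := fun i : Fin n => l i.succ
    have h : 𝔼 y, quadForm w y * linForm l y * linForm (fun _ => 1) y
        = 𝔼 y, quadForm w' y * linForm l' y * linForm (fun _ => 1) y
        + l 0 * 𝔼 y, quadForm w' y + 𝔼 y, linForm u y * linForm l' y
        + l 0 * 𝔼 y, linForm u y * linForm (fun _ => 1) y := by
      rw [expect_cons, mul_expect, mul_expect,
        ← expect_add_distrib, ← expect_add_distrib, ← expect_add_distrib]
      refine expect_congr rfl fun y _ => ?_
      simp only [linForm_cons, quadForm_cons, sgn_true, sgn_false]; ring
    rw [h, ih, expect_quadForm, expect_linForm_mul, expect_linForm_mul, Fin.sum_univ_succ,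
      vertexSum_zero]
    simp only [vertexSum_succ, mul_add, Finset.sum_add_distrib, mul_one]
    rw [Finset.sum_congr rfl fun i _ => mul_comm (u i) (l' i)]
    ring

lemma expect_linForm_sq_mul_sum_sq {n : ℕ} (l : Fin n → ℝ) :
    𝔼 y, linForm l y ^ 2 * linForm (fun _ => 1) y ^ 2
      = (n - 2) * ∑ i, l i ^ 2 + 2 * (∑ i, l i) ^ 2 := by
  induction n with
  | zero => simp [linForm]
  | succ n ih =>
    set l' := fun i : Fin n => l i.succ
    have h : 𝔼 y, linForm l y ^ 2 * linForm (fun _ => 1) y ^ 2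
        = 𝔼 y, linForm l' y ^ 2 * linForm (fun _ => 1) y ^ 2
        + 𝔼 y, linForm l' y ^ 2 + 4 * l 0 * 𝔼 y, linForm l' y * linForm (fun _ => 1) y
        + l 0 ^ 2 * 𝔼 y : Fin n → Bool, linForm (fun _ => 1) y ^ 2 + l 0 ^ 2 := by
      rw [expect_cons, mul_expect, mul_expect,
        ← expect_add_distrib, ← expect_add_distrib, ← expect_add_distrib, ← expect_add_const]
      refine expect_congr rfl fun y _ => ?_
      simp only [linForm_cons, sgn_true, sgn_false]; ring
    rw [h, ih, expect_linForm_mul, expect_linForm_sq, expect_linForm_sq, Fin.sum_univ_succ,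
      Fin.sum_univ_succ]
    simp
    ring

lemma expect_quadForm_sq_mul_sum_sq {n : ℕ} (w : Fin n → Fin n → ℝ) :
    𝔼 y, quadForm w y ^ 2 * linForm (fun _ => 1) y ^ 2
      = 2 * ∑ i, vertexSum w i ^ 2 + (n - 4) * pairSum fun i j => w i j ^ 2 := by
  induction n with
  | zero => simp [linForm, pairSum]
  | succ n ih =>
    set u := fun j : Fin n => w 0 j.succ
    set w' := fun i j : Fin n => w i.succ j.succ
    have h : 𝔼 y, quadForm w y ^ 2 * linForm (fun _ => 1) y ^ 2
        = 𝔼 y, quadForm w' y ^ 2 * linForm (fun _ => 1) y ^ 2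
        + 𝔼 y, quadForm w' y ^ 2 + 4 * 𝔼 y, quadForm w' y * linForm u y * linForm (fun _ => 1) y
        + 𝔼 y, linForm u y ^ 2 * linForm (fun _ => 1) y ^ 2 + 𝔼 y, linForm u y ^ 2 := by
      rw [expect_cons, mul_expect,
        ← expect_add_distrib, ← expect_add_distrib, ← expect_add_distrib, ← expect_add_distrib]
      refine expect_congr rfl fun y _ => ?_
      simp only [linForm_cons, quadForm_cons, sgn_true, sgn_false]; ring
    rw [h, ih, expect_quadForm_sq, expect_quadForm_mul_linForm_mul_sum,
      expect_linForm_sq_mul_sum_sq, expect_linForm_sq, Fin.sum_univ_succ, vertexSum_zero,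
      pairSum_succ]
    have h2 : ∑ i : Fin n, vertexSum w i.succ ^ 2
        = ∑ i, u i ^ 2 + 2 * ∑ i, u i * vertexSum w' i + ∑ i, vertexSum w' i ^ 2 := by
      rw [Finset.mul_sum, ← Finset.sum_add_distrib, ← Finset.sum_add_distrib]
      refine Finset.sum_congr rfl fun i _ => ?_
      rw [vertexSum_succ]; ring
    rw [h2]
    push_cast
    ring

lemma expect_quadForm_one_mul_sq {n : ℕ} (w : Fin n → Fin n → ℝ) :
    𝔼 y, quadForm (fun _ _ => 1) y * quadForm w y ^ 2
      = ∑ i, vertexSum w i ^ 2 - 2 * pairSum fun i j => w i j ^ 2 := by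
  have h : 𝔼 y, quadForm (fun _ _ => 1) y * quadForm w y ^ 2
      = (1 / 2) * 𝔼 y, quadForm w y ^ 2 * linForm (fun _ => 1) y ^ 2
        + (- n / 2) * 𝔼 y, quadForm w y ^ 2 := by
    rw [mul_expect, mul_expect, ← expect_add_distrib]
    refine expect_congr rfl fun y _ => ?_
    rw [quadForm_one]; ring
  rw [h, expect_quadForm_sq_mul_sum_sq, expect_quadForm_sq]; ring

/-- The square of a sum of `n` signs has the exponential moments of the square of a centred
Gaussian variable of variance `n`, at most. -/
lemma expect_exp_sum_sq_le (n : ℕ) {θ : ℝ} (h0 : 0 ≤ θ) (h1 : 2 * θ * n < 1) :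
    𝔼 y : Fin n → Bool, Real.exp (θ * linForm (fun _ => 1) y ^ 2)
      ≤ 1 / Real.sqrt (1 - 2 * θ * n) := by
  induction n generalizing θ with
  | zero => simp [linForm]
  | succ n ih =>
    push_cast at h1 ⊢
    have hn : (0 : ℝ) ≤ n := n.cast_nonneg
    have hq1 : 2 * θ < 1 := by nlinarith [mul_nonneg h0 hn]
    have h2 : 2 * (θ + 2 * θ ^ 2) * n < 1 := by
      nlinarith [mul_nonneg h0 hn, mul_nonneg (mul_nonneg h0 h0) hn]
    have step : ∀ y : Fin n → Bool,
        (Real.exp (θ * linForm (fun _ => 1) (Fin.cons true y : Fin (n + 1) → Bool) ^ 2)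
          + Real.exp (θ * linForm (fun _ => 1) (Fin.cons false y : Fin (n + 1) → Bool) ^ 2)) / 2
        ≤ Real.exp θ * Real.exp ((θ + 2 * θ ^ 2) * linForm (fun _ => 1) y ^ 2) := by
      intro y
      simp only [linForm_cons, sgn_true, sgn_false]
      set S := linForm (fun _ => 1) y
      have e1 : θ * (1 * 1 + S) ^ 2 = (θ + θ * S ^ 2) + 2 * θ * S := by ring
      have e2 : θ * (1 * -1 + S) ^ 2 = (θ + θ * S ^ 2) + -(2 * θ * S) := by ring
      rw [e1, e2, Real.exp_add _ (2 * θ * S), Real.exp_add _ (-(2 * θ * S)), ← mul_add,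
        mul_div_assoc, ← Real.cosh_eq]
      calc _ ≤ Real.exp (θ + θ * S ^ 2) * Real.exp ((2 * θ * S) ^ 2 / 2) :=
            mul_le_mul_of_nonneg_left (Real.cosh_le_exp_half_sq _) (Real.exp_nonneg _)
        _ = _ := by rw [← Real.exp_add, ← Real.exp_add]; ring_nf
    rw [expect_cons]
    have hpos1 : 0 < 1 - 2 * (θ + 2 * θ ^ 2) * n := by linarith
    have hpos2 : 0 < 1 - 2 * θ * (n + 1) := by linarith
    calc _ ≤ Real.exp θ * 𝔼 y : Fin n → Bool,
          Real.exp ((θ + 2 * θ ^ 2) * linForm (fun _ => 1) y ^ 2) := by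
          rw [mul_expect]; exact expect_le_expect fun y _ => step y
      _ ≤ Real.exp θ * (1 / Real.sqrt (1 - 2 * (θ + 2 * θ ^ 2) * n)) :=
          mul_le_mul_of_nonneg_left (ih (by positivity) h2) (Real.exp_nonneg _)
      _ ≤ _ := by
          have he : Real.exp θ = Real.sqrt (Real.exp (2 * θ)) := by
            rw [Real.sqrt_eq_rpow, ← Real.exp_mul]; ring_nf
          have hexp : Real.exp (2 * θ) ≤ 1 / (1 - 2 * θ) := by
            have := Real.one_sub_le_exp_neg (2 * θ)
            rw [Real.exp_neg] at this
            rw [le_div_iff₀ (by linarith)]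
            calc _ ≤ Real.exp (2 * θ) * (Real.exp (2 * θ))⁻¹ := by gcongr
              _ = 1 := by rw [mul_inv_cancel₀ (Real.exp_pos _).ne']
          rw [he, mul_one_div, ← Real.sqrt_div (Real.exp_nonneg _), one_div, ← Real.sqrt_inv]
          apply Real.sqrt_le_sqrt
          rw [← one_div, div_le_div_iff₀ hpos1 hpos2]
          calc _ ≤ 1 / (1 - 2 * θ) * (1 - 2 * θ * (n + 1)) := by gcongr
            _ ≤ _ := by
              rw [div_mul_eq_mul_div, div_le_iff₀ (by linarith)]
              nlinarith [mul_nonneg (pow_nonneg h0 3) hn]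

/-! ### Exponential inequalities -/

lemma norm_one_add_le_exp (u : ℂ) : ‖1 + u‖ ≤ Real.exp (u.re + ‖u‖ ^ 2 / 2) := by
  apply le_of_sq_le_sq _ (Real.exp_nonneg _)
  rw [← Real.exp_nat_mul]
  have h : ‖1 + u‖ ^ 2 = 2 * (u.re + ‖u‖ ^ 2 / 2) + 1 := by
    rw [Complex.sq_norm, Complex.sq_norm, Complex.normSq_apply, Complex.normSq_apply]
    simp; ring
  rw [h]
  exact_mod_cast Real.add_one_le_exp _

lemma norm_exp_sub_quadratic_le {z : ℂ} (hz : z.re ≤ 1) :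
    ‖Complex.exp z - 1 - z‖ ≤ 5 * ‖z‖ ^ 2 := by
  rcases le_total ‖z‖ 1 with h | h
  · exact (Complex.norm_exp_sub_one_sub_id_le h).trans (by nlinarith [sq_nonneg ‖z‖])
  · have he : ‖Complex.exp z‖ ≤ 3 := by
      rw [Complex.norm_exp]
      exact (Real.exp_le_exp.2 hz).trans (by linarith [Real.exp_one_lt_d9])
    calc _ ≤ ‖Complex.exp z‖ + ‖(1 : ℂ)‖ + ‖z‖ :=
          (norm_sub_le _ _).trans (add_le_add_left (norm_sub_le _ _) _)
      _ ≤ _ := by rw [norm_one]; nlinarith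

lemma norm_exp_sub_quartic_le {z : ℂ} (hz : z.re ≤ 1) :
    ‖Complex.exp z - (1 + z + z ^ 2 / 2 + z ^ 3 / 6)‖ ≤ 6 * ‖z‖ ^ 4 := by
  rcases le_total ‖z‖ 1 with h | h
  · have := Complex.exp_bound h (n := 4) (by norm_num)
    simp only [Finset.sum_range_succ, Finset.sum_range_zero, Nat.factorial] at this
    norm_num at this
    refine this.trans ?_
    nlinarith [pow_nonneg (norm_nonneg z) 4]
  · have he : ‖Complex.exp z‖ ≤ 3 := by
      rw [Complex.norm_exp]
      exact (Real.exp_le_exp.2 hz).trans (by linarith [Real.exp_one_lt_d9])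
    have h2 : 1 ≤ ‖z‖ ^ 2 := one_le_pow₀ h
    have h3 : 1 ≤ ‖z‖ ^ 3 := one_le_pow₀ h
    have h4 : ‖z‖ ^ 3 ≤ ‖z‖ ^ 4 := pow_le_pow_right₀ h (by norm_num)
    have h5 : ‖z‖ ^ 2 ≤ ‖z‖ ^ 4 := pow_le_pow_right₀ h (by norm_num)
    have h6 : ‖z‖ ≤ ‖z‖ ^ 4 := le_self_pow₀ h (by norm_num)
    have hp : ‖(1 : ℂ) + z + z ^ 2 / 2 + z ^ 3 / 6‖ ≤ 1 + ‖z‖ + ‖z‖ ^ 2 / 2 + ‖z‖ ^ 3 / 6 := by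
      refine (norm_add_le _ _).trans (add_le_add ((norm_add_le _ _).trans
        (add_le_add ((norm_add_le _ _).trans ?_) ?_)) ?_) <;> simp
    refine (norm_sub_le _ _).trans ?_
    linarith

lemma expect_pow_two_sq_le {Ω : Type*} [Fintype Ω] [Nonempty Ω] (f : Ω → ℝ) :
    (𝔼 y, f y ^ 2) ^ 2 ≤ 𝔼 y, f y ^ 4 := by
  have := expect_mul_sq_le (fun _ : Ω => 1) fun y => f y ^ 2
  simpa [← pow_mul] using this

/-- For a centred complex random variable whose real part is bounded above, the modulus of the
exponential moment is governed by the real parts of the second and third moments. -/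
lemma norm_expect_exp_le {Ω : Type*} [Fintype Ω] [Nonempty Ω] (ζ : Ω → ℂ)
    (h0 : 𝔼 y, ζ y = 0) (h1 : ∀ y, (ζ y).re ≤ 1) :
    ‖𝔼 y, Complex.exp (ζ y)‖ ≤
      Real.exp ((𝔼 y, ζ y ^ 2).re / 2 + (𝔼 y, ζ y ^ 3).re / 6 + 20 * 𝔼 y, ‖ζ y‖ ^ 4) := by
  set u := 𝔼 y, Complex.exp (ζ y) - 1
  have hu : 𝔼 y, Complex.exp (ζ y) = 1 + u := by simp [u]
  have hone : (1 : ℂ) = 𝔼 _y : Ω, (1 : ℂ) := (Fintype.expect_const _).symm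
  have hu2 : ‖u‖ ≤ 5 * 𝔼 y, ‖ζ y‖ ^ 2 := by
    have : u = 𝔼 y, (Complex.exp (ζ y) - 1 - ζ y) := by
      rw [expect_sub_distrib, expect_sub_distrib, h0, ← hone, sub_zero]
    rw [this, mul_expect]
    exact (RCLike.norm_expect_le (K := ℂ)).trans
      (expect_le_expect fun y _ => norm_exp_sub_quadratic_le (h1 y))
  have hu4 : ‖u - ((𝔼 y, ζ y ^ 2) / 2 + (𝔼 y, ζ y ^ 3) / 6)‖ ≤ 6 * 𝔼 y, ‖ζ y‖ ^ 4 := by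
    have : u - ((𝔼 y, ζ y ^ 2) / 2 + (𝔼 y, ζ y ^ 3) / 6)
        = 𝔼 y, (Complex.exp (ζ y) - (1 + ζ y + ζ y ^ 2 / 2 + ζ y ^ 3 / 6)) := by
      rw [expect_sub_distrib, expect_add_distrib, expect_add_distrib, expect_add_distrib, h0,
        ← hone, ← expect_div, ← expect_div]
      ring
    rw [this, mul_expect]
    exact (RCLike.norm_expect_le (K := ℂ)).trans
      (expect_le_expect fun y _ => norm_exp_sub_quartic_le (h1 y))
  have hre := (Complex.re_le_norm _).trans hu4
  have hre2 : (u - ((𝔼 y, ζ y ^ 2) / 2 + (𝔼 y, ζ y ^ 3) / 6)).re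
      = u.re - ((𝔼 y, ζ y ^ 2).re / 2 + (𝔼 y, ζ y ^ 3).re / 6) := by
    simp
  have hsq := expect_pow_two_sq_le fun y => ‖ζ y‖
  have h2pos : 0 ≤ 𝔼 y, ‖ζ y‖ ^ 2 := expect_nonneg fun y _ => by positivity
  have h4pos : 0 ≤ 𝔼 y, ‖ζ y‖ ^ 4 := expect_nonneg fun y _ => by positivity
  have husq : ‖u‖ ^ 2 ≤ 25 * 𝔼 y, ‖ζ y‖ ^ 4 := by
    calc ‖u‖ ^ 2 ≤ (5 * 𝔼 y, ‖ζ y‖ ^ 2) ^ 2 := by gcongr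
      _ ≤ _ := by rw [mul_pow]; linarith
  rw [hu]
  refine (norm_one_add_le_exp u).trans (Real.exp_le_exp.2 ?_)
  rw [hre2] at hre
  linarith

lemma cubic_le_exp (x : ℝ) : 1 + x + x ^ 2 / 2 + x ^ 3 / 6 ≤ Real.exp x := by
  have h := fun x : ℝ => Real.add_one_le_exp x
  have hd : ∀ (f f' : ℝ → ℝ), (∀ x, HasDerivAt f (f' x) x) → f 0 = 0 →
      (∀ x, 0 ≤ f' x) → (∀ x, 0 ≤ x → 0 ≤ f x) ∧ ∀ x, x ≤ 0 → f x ≤ 0 := by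
    intro f f' hf h0 hp
    have : Monotone f := monotone_of_deriv_nonneg (fun x => (hf x).differentiableAt)
      fun x => by rw [(hf x).deriv]; exact hp x
    exact ⟨fun x hx => h0 ▸ this hx, fun x hx => h0 ▸ this hx⟩
  -- the quadratic remainder has the sign of `x`, so the cubic remainder is minimal at `0`
  obtain ⟨h2p, h2n⟩ := hd (fun x => Real.exp x - (1 + x + x ^ 2 / 2))
    (fun x => Real.exp x - (1 + x))
    (fun x => by
      have := (Real.hasDerivAt_exp x).sub
        (((hasDerivAt_id x).const_add 1).add ((hasDerivAt_pow 2 x).div_const 2))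
      exact this.congr_deriv (by norm_num)) (by simp) (fun x => by linarith [h x])
  have hd3 : ∀ x, HasDerivAt (fun x => Real.exp x - (1 + x + x ^ 2 / 2 + x ^ 3 / 6))
      (Real.exp x - (1 + x + x ^ 2 / 2)) x := fun x => by
    have := (Real.hasDerivAt_exp x).sub
      ((((hasDerivAt_id x).const_add 1).add ((hasDerivAt_pow 2 x).div_const 2)).add
        ((hasDerivAt_pow 3 x).div_const 6))
    exact this.congr_deriv (by push_cast; ring)
  have hcont : Continuous fun x => Real.exp x - (1 + x + x ^ 2 / 2 + x ^ 3 / 6) := by fun_prop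
  rcases le_total 0 x with hx | hx
  · have hm : MonotoneOn (fun x => Real.exp x - (1 + x + x ^ 2 / 2 + x ^ 3 / 6)) (Set.Ici 0) :=
      monotoneOn_of_deriv_nonneg (convex_Ici 0) hcont.continuousOn
        (fun x _ => (hd3 x).differentiableAt.differentiableWithinAt) fun x hx => by
          rw [interior_Ici] at hx
          rw [(hd3 x).deriv]; exact h2p x (le_of_lt hx)
    have := hm Set.self_mem_Ici hx hx
    simp at this; linarith
  · have hm : AntitoneOn (fun x => Real.exp x - (1 + x + x ^ 2 / 2 + x ^ 3 / 6)) (Set.Iic 0) :=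
      antitoneOn_of_deriv_nonpos (convex_Iic 0) hcont.continuousOn
        (fun x _ => (hd3 x).differentiableAt.differentiableWithinAt) fun x hx => by
          rw [interior_Iic] at hx
          rw [(hd3 x).deriv]; exact h2n x (le_of_lt hx)
    have := hm hx Set.self_mem_Iic hx
    simp at this; linarith

/-- The pointwise inequality that lets the red and the blue edge probabilities add up to `1`. Both
summands are tangent at `u = 0`; the cosine supplies the negative quadratic term that the red
one needs, up to a factor `1 - δ` which pays for the cubic terms. -/
lemma one_le_red_add_blue {p₀ p δ c : ℝ} (hp₀ : 0 < p₀) (hp : p₀ ≤ p) (hp2 : p ≤ 1 / 2)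
    (hδ : 0 < δ) (hδ1 : δ ≤ 1) (hc : 0 < c) (hc2 : c ^ 2 = p₀ * δ ^ 2 / 288) (u : ℝ) :
    1 ≤ p * Real.exp (-u) *
        (1 - (1 - δ) * c ^ 2 * (1 + p / (1 - p)) * (1 - Real.cos (u / c)))
      + (1 - p) * Real.exp (p / (1 - p) * u) := by
  have hppos : 0 < p := hp₀.trans_le hp
  have h1p : 0 < 1 - p := by linarith
  obtain ⟨r, hr⟩ : ∃ r, r = p / (1 - p) := ⟨_, rfl⟩
  have hrp : (1 - p) * r = p := by rw [hr]; field_simp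
  have hr0 : 0 < r := hr ▸ div_pos hppos h1p
  have hr1 : r ≤ 1 := by rw [hr, div_le_one h1p]; linarith
  have hrp0 : p₀ ≤ r := hp.trans (hrp ▸ mul_le_of_le_one_left hr0.le (by linarith))
  rw [← hr]
  obtain ⟨X, hX⟩ : ∃ X, X = (1 - δ) * c ^ 2 * (1 + r) * (1 - Real.cos (u / c)) := ⟨_, rfl⟩
  rw [← hX]
  have hA : 0 ≤ (1 - δ) * (1 + r) := mul_nonneg (by linarith) (by linarith)
  have hX1 : X ≤ (1 - δ) * (1 + r) * u ^ 2 / 2 := by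
    have := Real.one_sub_sq_div_two_le_cos (x := u / c)
    rw [div_pow] at this
    have h2 : c ^ 2 * (1 - Real.cos (u / c)) ≤ u ^ 2 / 2 := by
      calc _ ≤ c ^ 2 * (u ^ 2 / c ^ 2 / 2) := by gcongr; linarith
        _ = _ := by field_simp
    have := mul_le_mul_of_nonneg_left h2 hA
    rw [hX]; linarith
  have hX2 : X ≤ 4 * c ^ 2 := by
    have h2 : c ^ 2 * (1 - Real.cos (u / c)) ≤ c ^ 2 * 2 := by
      gcongr; linarith [Real.neg_one_le_cos (u / c)]
    have h3 : (1 - δ) * (1 + r) ≤ 1 * 2 := by gcongr <;> linarith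
    rw [one_mul] at h3
    have h4 : 0 ≤ c ^ 2 * (1 - Real.cos (u / c)) := by
      have := Real.cos_le_one (u / c); exact mul_nonneg (by positivity) (by linarith)
    rw [hX]
    calc _ = (1 - δ) * (1 + r) * (c ^ 2 * (1 - Real.cos (u / c))) := by ring
      _ ≤ 2 * (c ^ 2 * 2) := by gcongr
      _ = _ := by ring
  have e0 : 0 < Real.exp (-u) := Real.exp_pos _
  obtain ⟨a, ha⟩ : ∃ a, a = δ / 3 := ⟨_, rfl⟩
  have ha0 : 0 < a := by rw [ha]; positivity
  have ha1 : a ≤ 1 / 3 := by rw [ha]; linarith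
  have hca : c ^ 2 = p₀ * a ^ 2 / 32 := by rw [hc2, ha]; ring
  suffices h : p * Real.exp (-u) * X ≤ p * Real.exp (-u) + (1 - p) * Real.exp (r * u) - 1 by
    linarith
  rcases le_total |u| a with hu | hu
  · have hc1 := cubic_le_exp (-u)
    have hc3 := cubic_le_exp (r * u)
    have hlow : p * ((1 + r) * u ^ 2 / 2 * (1 - |u| / 3)) ≤
        p * Real.exp (-u) + (1 - p) * Real.exp (r * u) - 1 := by
      have h1 := mul_le_mul_of_nonneg_left hc1 hppos.le
      have h2 := mul_le_mul_of_nonneg_left hc3 h1p.le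
      have e : (1 - p) * (1 + r * u + (r * u) ^ 2 / 2 + (r * u) ^ 3 / 6)
          = 1 - p + p * u + p * r * u ^ 2 / 2 + p * r ^ 2 * u ^ 3 / 6 := by
        linear_combination (u + r * u ^ 2 / 2 + r ^ 2 * u ^ 3 / 6) * hrp
      have h3 : p * ((1 - r ^ 2) * u ^ 3) ≤ p * ((1 + r) * u ^ 2 * |u|) := by
        have hu3 : u ^ 3 ≤ u ^ 2 * |u| := by
          rw [pow_succ]; exact mul_le_mul_of_nonneg_left (le_abs_self u) (sq_nonneg u)
        have h4 : (1 - r ^ 2) * u ^ 3 ≤ (1 - r ^ 2) * (u ^ 2 * |u|) :=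
          mul_le_mul_of_nonneg_left hu3 (by nlinarith)
        have h5 : (1 - r ^ 2) * (u ^ 2 * |u|) ≤ (1 + r) * (u ^ 2 * |u|) :=
          mul_le_mul_of_nonneg_right (by nlinarith) (by positivity)
        exact mul_le_mul_of_nonneg_left (by linarith) hppos.le
      have e2 : p * (1 + -u + (-u) ^ 2 / 2 + (-u) ^ 3 / 6)
          = p - p * u + p * u ^ 2 / 2 - p * u ^ 3 / 6 := by ring
      have e3 : p * ((1 + r) * u ^ 2 / 2 * (1 - |u| / 3))
          = p * u ^ 2 / 2 + p * r * u ^ 2 / 2 - p * ((1 + r) * u ^ 2 * |u|) / 6 := by ring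
      have e4 : p * ((1 - r ^ 2) * u ^ 3) = p * u ^ 3 - p * r ^ 2 * u ^ 3 := by ring
      linarith
    refine le_trans ?_ hlow
    have hexp : Real.exp (-u) ≤ 1 + 2 * a := by
      have h6 : Real.exp (-u) ≤ Real.exp a := Real.exp_le_exp.2 ((neg_le_abs u).trans hu)
      have h7 := Real.add_one_le_exp (-a)
      rw [Real.exp_neg] at h7
      have h8 : Real.exp a * (1 - a) ≤ 1 := by
        calc _ ≤ Real.exp a * (Real.exp a)⁻¹ := by gcongr; linarith
          _ = 1 := mul_inv_cancel₀ (Real.exp_pos a).ne'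
      have h9 : 1 ≤ (1 + 2 * a) * (1 - a) := by
        have : 0 ≤ a * (1 - 2 * a) := mul_nonneg ha0.le (by linarith)
        linarith
      exact h6.trans (le_of_mul_le_mul_right (h8.trans h9) (by linarith))
    have hkey : Real.exp (-u) * (1 - δ) ≤ 1 - |u| / 3 := by
      have h9 : Real.exp (-u) * (1 - δ) ≤ (1 + 2 * a) * (1 - δ) :=
        mul_le_mul_of_nonneg_right hexp (by linarith)
      have h10 : (1 + 2 * a) * (1 - δ) = 1 - a - 6 * a ^ 2 := by rw [ha]; ring
      have := sq_nonneg a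
      linarith
    calc p * Real.exp (-u) * X
        ≤ p * Real.exp (-u) * ((1 - δ) * (1 + r) * u ^ 2 / 2) := by gcongr
      _ = p * ((1 + r) * u ^ 2 / 2 * (Real.exp (-u) * (1 - δ))) := by ring
      _ ≤ _ := by gcongr
  · have hXe : p * Real.exp (-u) * X ≤ p * Real.exp (-u) * (4 * c ^ 2) := by gcongr
    refine hXe.trans ?_
    rcases le_total 0 u with hu0 | hu0
    · rw [abs_of_nonneg hu0] at hu
      have h1 : 1 + r * u + (r * u) ^ 2 / 2 ≤ Real.exp (r * u) :=
        Real.quadratic_le_exp_of_nonneg (by positivity)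
      have h2 := Real.add_one_le_exp (-u)
      have h3 : Real.exp (-u) ≤ 1 := Real.exp_le_one_iff.2 (by linarith)
      have h4 := mul_le_mul_of_nonneg_left h1 h1p.le
      have h5 := mul_le_mul_of_nonneg_left h2 hppos.le
      have e : (1 - p) * (1 + r * u + (r * u) ^ 2 / 2) = 1 - p + p * u + p * r * u ^ 2 / 2 := by
        linear_combination (u + r * u ^ 2 / 2) * hrp
      have h6 : a ^ 2 ≤ u ^ 2 := by gcongr
      have h7 : 4 * c ^ 2 ≤ r * u ^ 2 / 2 := by
        rw [hca]
        have := mul_le_mul hrp0 h6 (by positivity) hr0.le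
        have := mul_pos hp₀ (pow_pos ha0 2)
        linarith
      have h8 : p * Real.exp (-u) * (4 * c ^ 2) ≤ p * 1 * (r * u ^ 2 / 2) := by gcongr
      linarith
    · rw [abs_of_nonpos hu0] at hu
      obtain ⟨v, hv⟩ : ∃ v, v = -u := ⟨_, rfl⟩
      have huv : u = -v := by rw [hv]; ring
      subst huv
      rw [neg_neg] at *
      have hv0 : 0 ≤ v := ha0.le.trans hu
      have h1 := Real.add_one_le_exp (r * -v)
      have h2 : 1 + v + v ^ 2 / 2 ≤ Real.exp v := Real.quadratic_le_exp_of_nonneg hv0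
      have h4 := mul_le_mul_of_nonneg_left h1 h1p.le
      have e : (1 - p) * (r * -v + 1) = 1 - p - p * v := by linear_combination -v * hrp
      have h5 : 4 * c ^ 2 ≤ a ^ 2 / 8 := by
        have : p₀ * a ^ 2 ≤ 1 * a ^ 2 := by gcongr; linarith
        rw [hca]; linarith
      have h6 : 4 * c ^ 2 * (1 + v + v ^ 2 / 2) ≤ v ^ 2 / 2 := by
        have h7 : 4 * c ^ 2 * (1 + v + v ^ 2 / 2) ≤ a ^ 2 / 8 * (1 + v + v ^ 2 / 2) := by
          gcongr
        have h8 : a ^ 2 ≤ v ^ 2 := by gcongr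
        have h12 : a ^ 2 ≤ 1 := pow_le_one₀ ha0.le (by linarith)
        have h9 : a ^ 2 * v ≤ v ^ 2 := by
          rw [sq v]
          refine mul_le_mul_of_nonneg_right (le_trans ?_ hu) hv0
          exact pow_le_of_le_one ha0.le (by linarith) two_ne_zero
        have h10 : a ^ 2 * v ^ 2 ≤ v ^ 2 := mul_le_of_le_one_left (sq_nonneg v) h12
        have := sq_nonneg v
        linarith
      have h11 : 1 + v ≤ (1 - 4 * c ^ 2) * Real.exp v := by
        have h12 : a ^ 2 ≤ 1 := pow_le_one₀ ha0.le (by linarith)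
        have := mul_le_mul_of_nonneg_left h2 (by linarith : (0 : ℝ) ≤ 1 - 4 * c ^ 2)
        linarith
      have h12 := mul_le_mul_of_nonneg_left h11 hppos.le
      linarith

/-! ### Ramsey numbers and random colourings -/

/-- The finite Ramsey theorem for two colours, inside a finite set `s` of vertices. -/
lemma exists_forall_isNClique (ℓ k : ℕ) : ∃ n : ℕ, ∀ (V : Type) (G : SimpleGraph V) (s : Finset V),
    n ≤ #s → (∃ t ⊆ s, G.IsNClique ℓ t) ∨ ∃ t ⊆ s, Gᶜ.IsNClique k t := by
  classical
  induction ℓ generalizing k with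
  | zero => exact ⟨0, fun V G s _ => Or.inl ⟨∅, by simp, by simp⟩⟩
  | succ ℓ ihℓ =>
    induction k with
    | zero => exact ⟨0, fun V G s _ => Or.inr ⟨∅, by simp, by simp⟩⟩
    | succ k ihk =>
      obtain ⟨n₁, h₁⟩ := ihℓ (k + 1)
      obtain ⟨n₂, h₂⟩ := ihk
      refine ⟨n₁ + n₂ + 1, fun V G s hs => ?_⟩
      obtain ⟨v, hv⟩ : s.Nonempty := Finset.card_pos.1 (by omega)
      have hcard := Finset.card_filter_add_card_filter_not (s := s.erase v) (G.Adj v)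
      rw [Finset.card_erase_of_mem hv] at hcard
      have hsub : ∀ (P : V → Prop) [DecidablePred P], (s.erase v).filter P ⊆ s :=
        fun P _ => (Finset.filter_subset _ _).trans (Finset.erase_subset _ _)
      rcases le_or_gt n₁ #((s.erase v).filter (G.Adj v)) with h | h
      · rcases h₁ V G _ h with ⟨t, hts, ht⟩ | ⟨t, hts, ht⟩
        · refine Or.inl ⟨insert v t, Finset.insert_subset hv (hts.trans (hsub _)), ht.insert ?_⟩
          exact fun b hb => (Finset.mem_filter.1 (hts hb)).2
        · exact Or.inr ⟨t, hts.trans (hsub _), ht⟩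
      · rcases h₂ V G ((s.erase v).filter fun b => ¬ G.Adj v b) (by omega) with
          ⟨t, hts, ht⟩ | ⟨t, hts, ht⟩
        · exact Or.inl ⟨t, hts.trans (hsub _), ht⟩
        · refine Or.inr ⟨insert v t, Finset.insert_subset hv (hts.trans (hsub _)), ht.insert ?_⟩
          intro b hb
          have := Finset.mem_filter.1 (hts hb)
          rw [SimpleGraph.compl_adj]
          exact ⟨(Finset.ne_of_mem_erase this.1).symm, this.2⟩

lemma exists_ramseyProperty (ℓ k : ℕ) : ∃ n, RamseyProperty ℓ k n := by
  obtain ⟨n, hn⟩ := exists_forall_isNClique ℓ k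
  refine ⟨n, fun G => ?_⟩
  rcases hn (Fin n) G Finset.univ (by simp) with ⟨t, -, ht⟩ | ⟨t, -, ht⟩
  · exact Or.inl ht.not_cliqueFree
  · exact Or.inr ht.not_cliqueFree

lemma ramseyProperty_mono {ℓ k m n : ℕ} (hmn : m ≤ n) (h : RamseyProperty ℓ k m) :
    RamseyProperty ℓ k n := by
  intro G
  let e := Fin.castLEEmb hmn
  have hc : (G.comap e)ᶜ = Gᶜ.comap e := by
    ext a b; simp [SimpleGraph.compl_adj]
  rcases h (G.comap e) with h | h
  · exact Or.inl fun hG => h (hG.comap ⟨(SimpleGraph.Embedding.comap e G).toCopy⟩)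
  · rw [hc] at h
    exact Or.inr fun hG => h (hG.comap ⟨(SimpleGraph.Embedding.comap e Gᶜ).toCopy⟩)

lemma lt_ramseyNumber {ℓ k n : ℕ} (h : ¬ RamseyProperty ℓ k n) : n < ramseyNumber ℓ k := by
  by_contra! hle
  have hmem : RamseyProperty ℓ k (ramseyNumber ℓ k) := Nat.sInf_mem (exists_ramseyProperty ℓ k)
  exact h (ramseyProperty_mono hle hmem)

/-- The product of `w i j` over the pairs `i < j`. -/
def pairProd {M : Type*} [CommMonoid M] {n : ℕ} (w : Fin n → Fin n → M) : M :=
  ∏ i, ∏ j, if i < j then w i j else 1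

lemma prod_image_edges {n ℓ : ℕ} (f : Fin ℓ ↪ Fin n) (g : Sym2 (Fin n) → ℝ) :
    ∏ e ∈ (univ.filter fun e : Fin ℓ × Fin ℓ => e.1 < e.2).image fun e => s(f e.1, f e.2), g e
      = pairProd fun i j => g s(f i, f j) := by
  rw [Finset.prod_image, Finset.prod_filter, Fintype.prod_prod_type, pairProd]
  rintro ⟨a, b⟩ hab ⟨c, d⟩ hcd h
  simp only [Finset.coe_filter, Finset.mem_univ, true_and, Set.mem_ofPred_eq] at hab hcd
  simp only [Sym2.eq_iff, f.injective.eq_iff] at h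
  rcases h with ⟨rfl, rfl⟩ | ⟨rfl, rfl⟩
  · rfl
  · exact absurd hab hcd.not_gt

/-- A random set of independent edges contains a given set with the expected probability. -/
lemma sum_weight_of_subset {E : Type*} [Fintype E] [DecidableEq E] (b c : E → ℝ)
    (hbc : ∀ e, b e + c e = 1) (S : Finset E) :
    ∑ A : Finset E, (if S ⊆ A then (∏ e ∈ A, b e) * ∏ e ∈ univ \ A, c e else 0)
      = ∏ e ∈ S, b e := by
  have h := Finset.prod_add b (fun e => if e ∈ S then 0 else c e) univ
  rw [Finset.powerset_univ] at h
  have hl : ∏ e, (b e + if e ∈ S then 0 else c e) = ∏ e ∈ S, b e := by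
    rw [← Finset.prod_filter_mul_prod_filter_not univ (· ∈ S)]
    rw [Finset.filter_univ_mem]
    rw [Finset.prod_congr rfl (g := b) fun e he => by simp [he],
      Finset.prod_congr (s₂ := univ.filter fun e => e ∉ S) (g := fun _ => 1) rfl
        fun e he => by simp [(Finset.mem_filter.1 he).2, hbc]]
    simp
  rw [← hl, h]
  refine Finset.sum_congr rfl fun A _ => ?_
  split_ifs with hA
  · congr 1
    refine Finset.prod_congr rfl fun e he => ?_
    rw [if_neg fun hS => (Finset.mem_sdiff.1 he).2 (hA hS)]
  · obtain ⟨e, heS, heA⟩ := Finset.not_subset.1 hA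
    rw [Finset.prod_eq_zero (s := univ \ A) (i := e) (by simp [heA]) (by simp [heS]), mul_zero]

/-- The first moment method: if the expected number of red `ℓ`-cliques and blue `k`-cliques is
less than one, some colouring has none. Cliques are counted with an order of their vertices. -/
lemma not_ramseyProperty_of_sum_lt {n ℓ k : ℕ} (B : Fin n → Fin n → ℝ)
    (hsymm : ∀ u v, B u v = B v u) (h0 : ∀ u v, 0 ≤ B u v) (h1 : ∀ u v, B u v ≤ 1)
    (hlt : ∑ f : Fin ℓ ↪ Fin n, pairProd (fun i j => 1 - B (f i) (f j))
      + ∑ f : Fin k ↪ Fin n, pairProd (fun i j => B (f i) (f j)) < 1) :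
    ¬ RamseyProperty ℓ k n := by
  classical
  intro hR
  let b : Sym2 (Fin n) → ℝ := Sym2.lift ⟨B, hsymm⟩
  have hb0 : ∀ e, 0 ≤ b e := fun e => e.ind fun u v => h0 u v
  have hb1 : ∀ e, b e ≤ 1 := fun e => e.ind fun u v => h1 u v
  let wt : Finset (Sym2 (Fin n)) → ℝ := fun A => (∏ e ∈ A, b e) * ∏ e ∈ univ \ A, (1 - b e)
  have hwt : ∀ A, 0 ≤ wt A := fun A => mul_nonneg (Finset.prod_nonneg fun e _ => hb0 e)
    (Finset.prod_nonneg fun e _ => sub_nonneg.2 (hb1 e))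
  let T : ∀ {m : ℕ}, (Fin m ↪ Fin n) → Finset (Sym2 (Fin n)) := fun {m} f =>
    (univ.filter fun e : Fin m × Fin m => e.1 < e.2).image fun e => s(f e.1, f e.2)
  have hT : ∀ {m : ℕ} (f : Fin m ↪ Fin n) (A : Finset (Sym2 (Fin n))),
      (∀ i j, i ≠ j → s(f i, f j) ∈ A) → T f ⊆ A := by
    intro m f A h e he
    obtain ⟨⟨i, j⟩, hij, rfl⟩ := Finset.mem_image.1 he
    exact h i j (Finset.mem_filter.1 hij).2.ne
  have htot : ∑ A, wt A = 1 := by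
    have := sum_weight_of_subset b (fun e => 1 - b e) (fun e => by ring) ∅
    simpa using this
  have hblue : ∀ f : Fin k ↪ Fin n,
      ∑ A, (if T f ⊆ A then wt A else 0) = pairProd fun i j => B (f i) (f j) := fun f => by
    rw [sum_weight_of_subset b (fun e => 1 - b e) (fun e => by ring), prod_image_edges]
    rfl
  have hred : ∀ f : Fin ℓ ↪ Fin n,
      ∑ A, (if T f ⊆ univ \ A then wt A else 0) = pairProd fun i j => 1 - B (f i) (f j) :=
    fun f => by
      have h := sum_weight_of_subset (fun e => 1 - b e) b (fun e => by ring) (T f)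
      rw [prod_image_edges] at h
      rw [← compl_bijective.sum_comp] at h
      refine Eq.trans (Finset.sum_congr rfl fun A _ => ?_) h
      simp only [Finset.compl_eq_univ_sdiff, wt, Finset.sdiff_sdiff_eq_self
        (Finset.subset_univ A)]
      rw [mul_comm]
  have hcover : ∀ A, wt A ≤ ∑ f : Fin ℓ ↪ Fin n, (if T f ⊆ univ \ A then wt A else 0)
      + ∑ f : Fin k ↪ Fin n, (if T f ⊆ A then wt A else 0) := by
    intro A
    have hn1 : 0 ≤ ∑ f : Fin ℓ ↪ Fin n, (if T f ⊆ univ \ A then wt A else 0) :=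
      Finset.sum_nonneg fun f _ => by split_ifs; exacts [hwt A, le_rfl]
    have hn2 : 0 ≤ ∑ f : Fin k ↪ Fin n, (if T f ⊆ A then wt A else 0) :=
      Finset.sum_nonneg fun f _ => by split_ifs; exacts [hwt A, le_rfl]
    let G : SimpleGraph (Fin n) :=
      { Adj := fun u v => u ≠ v ∧ s(u, v) ∉ A
        symm := ⟨fun u v h => ⟨h.1.symm, by rw [Sym2.eq_swap]; exact h.2⟩⟩
        loopless := ⟨fun u h => h.1 rfl⟩ }
    rcases hR G with h | h
    · obtain ⟨φ⟩ := (SimpleGraph.not_cliqueFree_iff_top_isContained _).1 h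
      let F : Fin ℓ ↪ Fin n := ⟨φ, φ.injective⟩
      have hsub : T F ⊆ univ \ A := hT _ _ fun i j hij => by
        have : G.Adj (φ i) (φ j) := φ.toHom.map_adj hij
        exact Finset.mem_sdiff.2 ⟨Finset.mem_univ _, this.2⟩
      have := Finset.single_le_sum (f := fun f : Fin ℓ ↪ Fin n =>
        if T f ⊆ univ \ A then wt A else 0) (fun f _ => by
          split_ifs; exacts [hwt A, le_rfl]) (Finset.mem_univ F)
      rw [if_pos hsub] at this
      linarith
    · obtain ⟨φ⟩ := (SimpleGraph.not_cliqueFree_iff_top_isContained _).1 h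
      let F : Fin k ↪ Fin n := ⟨φ, φ.injective⟩
      have hsub : T F ⊆ A := hT _ _ fun i j hij => by
        have : Gᶜ.Adj (φ i) (φ j) := φ.toHom.map_adj hij
        rw [SimpleGraph.compl_adj] at this
        by_contra hA
        exact this.2 ⟨this.1, hA⟩
      have := Finset.single_le_sum (f := fun f : Fin k ↪ Fin n =>
        if T f ⊆ A then wt A else 0) (fun f _ => by
          split_ifs; exacts [hwt A, le_rfl]) (Finset.mem_univ F)
      rw [if_pos hsub] at this
      linarith
  have := Finset.sum_le_sum fun A (_ : A ∈ (univ : Finset (Finset (Sym2 (Fin n))))) => hcover A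
  rw [htot, Finset.sum_add_distrib, Finset.sum_comm, Finset.sum_comm (s := univ) (t := univ)
    (f := fun A (f : Fin k ↪ Fin n) => if T f ⊆ A then wt A else 0)] at this
  simp only [hblue, hred] at this
  linarith

/-- Restricting a uniformly random function along an injection gives a uniformly random
function. -/
lemma expect_comp_injective {ι κ Ω : Type*} [Fintype ι] [Fintype κ] [DecidableEq ι]
    [DecidableEq κ] [Fintype Ω] [Nonempty Ω] {f : ι → κ} (hf : Function.Injective f)
    (g : (ι → Ω) → ℝ) : 𝔼 x : κ → Ω, g (x ∘ f) = 𝔼 x : ι → Ω, g x := by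
  classical
  let e₁ : ι ⊕ ↥(Set.range f)ᶜ ≃ κ :=
    (Equiv.sumCongr (Equiv.ofInjective f hf) (Equiv.refl _)).trans (Equiv.Set.sumCompl _)
  let e : (κ → Ω) ≃ (ι → Ω) × (↥(Set.range f)ᶜ → Ω) :=
    (Equiv.arrowCongr e₁.symm (Equiv.refl Ω)).trans (Equiv.sumArrowEquivProdArrow _ _ _)
  have he : ∀ x, (e x).1 = x ∘ f := fun x => by
    ext i; simp [e, e₁, Equiv.sumArrowEquivProdArrow]
  have h1 : ∑ x : κ → Ω, g (x ∘ f)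
      = Fintype.card (↥(Set.range f)ᶜ → Ω) * ∑ x : ι → Ω, g x := by
    simp only [← he]
    rw [e.sum_comp fun q => g q.1, Fintype.sum_prod_type_right]
    simp
  have h2 : Fintype.card (κ → Ω)
      = Fintype.card (ι → Ω) * Fintype.card (↥(Set.range f)ᶜ → Ω) := by
    rw [Fintype.card_congr e, Fintype.card_prod]
  rw [Fintype.expect_eq_sum_div_card, Fintype.expect_eq_sum_div_card, h1, h2]
  push_cast
  have : (Fintype.card (↥(Set.range f)ᶜ → Ω) : ℝ) ≠ 0 := by
    exact_mod_cast Fintype.card_ne_zero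
  rw [mul_comm, mul_div_mul_right _ _ this]

/-- The first moment method for a graph whose edge `uv` is blue with probability `b (x u) (x v)`,
independently given the uniformly random vertex types `x`. -/
lemma not_ramseyProperty_of_types {Ω : Type*} [Fintype Ω] [Nonempty Ω] {n ℓ k : ℕ}
    (b : Ω → Ω → ℝ) (hsymm : ∀ u v, b u v = b v u) (h0 : ∀ u v, 0 ≤ b u v)
    (h1 : ∀ u v, b u v ≤ 1)
    (hlt : (n : ℝ) ^ ℓ * 𝔼 x : Fin ℓ → Ω, pairProd (fun i j => 1 - b (x i) (x j))
      + (n : ℝ) ^ k * 𝔼 x : Fin k → Ω, pairProd (fun i j => b (x i) (x j)) < 1) :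
    ¬ RamseyProperty ℓ k n := by
  have hcount : ∀ (m : ℕ) (c : Ω → Ω → ℝ), (∀ u v, 0 ≤ c u v) →
      𝔼 x : Fin n → Ω, ∑ f : Fin m ↪ Fin n, pairProd (fun i j => c (x (f i)) (x (f j)))
        ≤ (n : ℝ) ^ m * 𝔼 x : Fin m → Ω, pairProd (fun i j => c (x i) (x j)) := by
    intro m c hc
    have hpos : 0 ≤ 𝔼 x : Fin m → Ω, pairProd (fun i j => c (x i) (x j)) :=
      expect_nonneg fun x _ => Finset.prod_nonneg fun i _ => Finset.prod_nonneg fun j _ => by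
        split_ifs
        exacts [hc _ _, zero_le_one]
    rw [expect_sum_comm]
    have h : ∀ f : Fin m ↪ Fin n, 𝔼 x : Fin n → Ω, pairProd (fun i j => c (x (f i)) (x (f j)))
        = 𝔼 x : Fin m → Ω, pairProd (fun i j => c (x i) (x j)) := fun f =>
      expect_comp_injective f.injective fun x : Fin m → Ω => pairProd (fun i j => c (x i) (x j))
    rw [Finset.sum_congr rfl fun f _ => h f, Finset.sum_const, nsmul_eq_mul]
    refine mul_le_mul_of_nonneg_right ?_ hpos
    have : Fintype.card (Fin m ↪ Fin n) ≤ n ^ m := by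
      rw [Fintype.card_embedding_eq]; simpa using Nat.descFactorial_le_pow n m
    rw [Finset.card_univ]
    exact_mod_cast this
  have hex : ∃ x : Fin n → Ω,
      ∑ f : Fin ℓ ↪ Fin n, pairProd (fun i j => 1 - b (x (f i)) (x (f j)))
      + ∑ f : Fin k ↪ Fin n, pairProd (fun i j => b (x (f i)) (x (f j))) < 1 := by
    have := hcount ℓ (fun u v => 1 - b u v) fun u v => sub_nonneg.2 (h1 u v)
    have h2 := hcount k b h0
    obtain ⟨x, -, hx⟩ := exists_lt_of_expect_lt (s := univ) (a := (1 : ℝ)) univ_nonempty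
      (f := fun x : Fin n → Ω =>
        ∑ f : Fin ℓ ↪ Fin n, pairProd (fun i j => 1 - b (x (f i)) (x (f j)))
        + ∑ f : Fin k ↪ Fin n, pairProd (fun i j => b (x (f i)) (x (f j))))
      (by rw [expect_add_distrib]; linarith)
    exact ⟨x, hx⟩
  obtain ⟨x, hx⟩ := hex
  exact not_ramseyProperty_of_sum_lt (fun u v => b (x u) (x v)) (fun u v => hsymm _ _)
    (fun u v => h0 _ _) (fun u v => h1 _ _) hx

/-! ### Products over pairs and correlated sign vectors -/

/-- The normalised inner product of two sign vectors. -/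
noncomputable def corr (m : ℝ) {d : ℕ} (u v : Fin d → Bool) : ℝ := (∑ a, sgn (u a) * sgn (v a)) / m

lemma corr_comm (m : ℝ) {d : ℕ} (u v : Fin d → Bool) : corr m u v = corr m v u := by
  simp only [corr, mul_comm]

lemma pairProd_mono {n : ℕ} {w w' : Fin n → Fin n → ℝ} (h0 : ∀ i j, 0 ≤ w i j)
    (h : ∀ i j, w i j ≤ w' i j) : pairProd w ≤ pairProd w' := by
  refine Finset.prod_le_prod (fun i _ => Finset.prod_nonneg fun j _ => ?_) fun i _ =>
    Finset.prod_le_prod (fun j _ => ?_) fun j _ => ?_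
  all_goals split_ifs
  exacts [h0 i j, zero_le_one, h0 i j, zero_le_one, h i j, le_rfl]

lemma pairProd_nonneg {n : ℕ} {w : Fin n → Fin n → ℝ} (h0 : ∀ i j, 0 ≤ w i j) :
    0 ≤ pairProd w :=
  Finset.prod_nonneg fun i _ => Finset.prod_nonneg fun j _ => by
    split_ifs
    exacts [h0 i j, zero_le_one]

lemma pairProd_exp {n : ℕ} (w : Fin n → Fin n → ℝ) :
    pairProd (fun i j => Real.exp (w i j)) = Real.exp (pairSum w) := by
  simp only [pairProd, pairSum, Real.exp_sum]
  refine Finset.prod_congr rfl fun i _ => Finset.prod_congr rfl fun j _ => ?_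
  split_ifs <;> simp

lemma pairProd_mul {n : ℕ} (w w' : Fin n → Fin n → ℝ) :
    pairProd (fun i j => w i j * w' i j) = pairProd w * pairProd w' := by
  simp only [pairProd, ← Finset.prod_mul_distrib]
  refine Finset.prod_congr rfl fun i _ => Finset.prod_congr rfl fun j _ => ?_
  split_ifs <;> simp

lemma pairProd_const {n : ℕ} {a : ℝ} (ha : 0 < a) :
    pairProd (fun _ _ : Fin n => a) = Real.exp (Real.log a * (n * (n - 1) / 2)) := by
  rw [← pairSum_const, ← pairProd_exp]
  simp only [Real.exp_log ha]

lemma pairSum_sum {n : ℕ} {ι : Type*} (s : Finset ι) (w : ι → Fin n → Fin n → ℝ) :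
    pairSum (fun i j => ∑ a ∈ s, w a i j) = ∑ a ∈ s, pairSum (w a) := by
  refine Eq.trans (Finset.sum_congr rfl fun i _ => ?_) Finset.sum_comm
  refine Eq.trans (Finset.sum_congr rfl fun j _ => ?_) Finset.sum_comm
  split_ifs <;> simp

lemma pairSum_mul_corr (m : ℝ) {n d : ℕ} (w : Fin n → Fin n → ℝ) (x : Fin n → Fin d → Bool) :
    pairSum (fun i j => w i j * corr m (x i) (x j))
      = ∑ a, m⁻¹ * quadForm w (fun i => x i a) := by
  simp only [quadForm, ← pairSum_mul, ← pairSum_sum]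
  congr 1
  ext i j
  rw [corr, div_eq_inv_mul, Finset.mul_sum, Finset.mul_sum]
  exact Finset.sum_congr rfl fun a _ => by ring

/-- The coordinates of uniformly random sign vectors are independent. -/
lemma expect_prod_coord {K : Type*} [Semifield K] [CharZero K] {n d : ℕ} (g : (Fin n → Bool) → K) :
    𝔼 x : Fin n → Fin d → Bool, ∏ a, g (fun i => x i a) = (𝔼 y, g y) ^ d := by
  rw [expect_pow, Fintype.piFinset_univ]
  exact Fintype.expect_equiv (Equiv.piComm fun _ _ => Bool) _ _ fun x => rfl

/-! ### Blue cliques -/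

lemma expect_exp_quadForm_one_le (k : ℕ) {σ : ℝ} {a : ℝ} (hσ : σ = a * k) (h0 : 0 ≤ a)
    (h1 : σ ≤ 1 / 2) :
    𝔼 y : Fin k → Bool, Real.exp (a * quadForm (fun _ _ => 1) y)
      ≤ Real.exp (σ ^ 2 / 4 + σ ^ 3 / 6 + σ ^ 4) := by
  have hσ0 : 0 ≤ σ := by rw [hσ]; positivity
  have e : ∀ y : Fin k → Bool, Real.exp (a * quadForm (fun _ _ => 1) y)
      = Real.exp (-σ / 2) * Real.exp (a / 2 * linForm (fun _ => 1) y ^ 2) := fun y => by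
    rw [quadForm_one, ← Real.exp_add, hσ]; ring_nf
  simp only [e, ← mul_expect]
  have h2 : 2 * (a / 2) * k = σ := by rw [hσ]; ring
  have h := expect_exp_sum_sq_le k (θ := a / 2) (by positivity) (by rw [h2]; linarith)
  rw [h2] at h
  have hpos : 0 < 1 - σ := by linarith
  have hs : 1 / Real.sqrt (1 - σ) = Real.exp (-Real.log (1 - σ) / 2) := by
    rw [neg_div, Real.exp_neg, one_div, ← Real.log_sqrt hpos.le,
      Real.exp_log (Real.sqrt_pos.2 hpos)]
  have hlog := Real.abs_log_sub_add_sum_range_le (x := σ) (by rw [abs_of_nonneg hσ0]; linarith) 3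
  rw [abs_of_nonneg hσ0] at hlog
  have hl2 : σ ^ (3 + 1) / (1 - σ) ≤ 2 * σ ^ 4 := by
    rw [div_le_iff₀ hpos]
    have : 0 ≤ σ ^ 4 * (1 - 2 * σ) := mul_nonneg (by positivity) (by linarith)
    have e : σ ^ (3 + 1) = σ ^ 4 := rfl
    linarith
  have hl3 := (abs_le.1 (hlog.trans hl2)).1
  simp only [Finset.sum_range_succ, Finset.sum_range_zero] at hl3
  norm_num at hl3
  calc _ ≤ Real.exp (-σ / 2) * Real.exp (-Real.log (1 - σ) / 2) := by
        rw [← hs]; gcongr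
    _ ≤ _ := by
      rw [← Real.exp_add]
      apply Real.exp_le_exp.2
      linarith

/-- The probability of a blue clique: the tilt of the edge probabilities is exponential, and the
exponential moment factorises over the coordinates. -/
lemma expect_blue_le {k m d : ℕ} (hd : d = m ^ 2) (hm : 0 < m) {q t σ : ℝ} (hq : 0 < q)
    (ht : 0 ≤ t) (hσ : σ = t * k / m) (hσ1 : σ ≤ 1 / 2) :
    𝔼 x : Fin k → Fin d → Bool,
        pairProd (fun i j => min 1 (q * Real.exp (t * corr m (x i) (x j))))
      ≤ Real.exp (Real.log q * (k * (k - 1) / 2)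
        + m ^ 2 * (σ ^ 2 / 4 + σ ^ 3 / 6 + σ ^ 4)) := by
  have h1 : ∀ x : Fin k → Fin d → Bool,
      pairProd (fun i j => min 1 (q * Real.exp (t * corr m (x i) (x j))))
      ≤ Real.exp (Real.log q * (k * (k - 1) / 2))
        * ∏ a, Real.exp (t / m * quadForm (fun _ _ => 1) (fun i => x i a)) := by
    intro x
    refine (pairProd_mono (fun i j => by positivity) fun i j => min_le_right _ _).trans ?_
    rw [pairProd_mul, pairProd_const hq, pairProd_exp, ← Real.exp_sum]
    have := pairSum_mul_corr m (fun _ _ => 1) x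
    simp only [one_mul] at this
    rw [pairSum_mul, this, Finset.mul_sum]
    refine le_of_eq (congrArg _ (congrArg _ (Finset.sum_congr rfl fun a _ => ?_)))
    ring
  calc _ ≤ _ := expect_le_expect fun x _ => h1 x
    _ = Real.exp (Real.log q * (k * (k - 1) / 2))
        * (𝔼 y : Fin k → Bool, Real.exp (t / m * quadForm (fun _ _ => 1) y)) ^ d := by
      rw [← mul_expect, expect_prod_coord
        (g := fun y : Fin k → Bool => Real.exp (t / m * quadForm (fun _ _ => 1) y))]
    _ ≤ Real.exp (Real.log q * (k * (k - 1) / 2))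
        * (Real.exp (σ ^ 2 / 4 + σ ^ 3 / 6 + σ ^ 4)) ^ d := by
      refine mul_le_mul_of_nonneg_left (pow_le_pow_left₀
        (expect_nonneg fun y _ => Real.exp_nonneg _) ?_ _) (Real.exp_nonneg _)
      exact expect_exp_quadForm_one_le k (by rw [hσ]; ring) (by positivity) hσ1
    _ = _ := by rw [← Real.exp_nat_mul, ← Real.exp_add, hd]; push_cast; rfl

/-! ### Red cliques: the oscillatory mixture -/

/-- The value in `{-1, 0, 1}` encoded by an element of `Option Bool`. -/
def ternary (o : Option Bool) : ℝ := o.elim 0 sgn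

/-- The symmetric probability weights on `{-1, 0, 1}` with mass `lam` outside `0`. -/
noncomputable def ternaryWeight (lam : ℝ) (o : Option Bool) : ℝ :=
  o.elim (1 - lam) fun _ => lam / 2

/-- The product weight on matrices with independent entries in `{-1, 0, 1}`. -/
noncomputable def mixWeight (lam : ℝ) {n : ℕ} (w : Fin n → Fin n → Option Bool) : ℝ :=
  ∏ i, ∏ j, ternaryWeight lam (w i j)

lemma sum_prod_pairs {K : Type*} [CommSemiring K] {n : ℕ} {O : Type*} [Fintype O]
    (v : Fin n → Fin n → O → K) :
    ∑ w : Fin n → Fin n → O, ∏ i, ∏ j, v i j (w i j) = ∏ i, ∏ j, ∑ o, v i j o := by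
  classical
  simp only [Finset.prod_univ_sum, Fintype.piFinset_univ]

lemma sum_prod_mul_pairProd {K : Type*} [CommSemiring K] {n : ℕ} {O : Type*} [Fintype O]
    (p : O → K) (hp : ∑ o, p o = 1) (h : Fin n → Fin n → O → K) :
    ∑ w : Fin n → Fin n → O, (∏ i, ∏ j, p (w i j)) * pairProd (fun i j => h i j (w i j))
      = pairProd (fun i j => ∑ o, p o * h i j o) := by
  have := sum_prod_pairs fun (i j : Fin n) (o : O) => p o * if i < j then h i j o else 1
  simp only [Finset.prod_mul_distrib] at this
  refine this.trans ?_
  refine Finset.prod_congr rfl fun i _ => Finset.prod_congr rfl fun j _ => ?_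
  split_ifs <;> simp [hp]

lemma sum_ternaryWeight (lam : ℝ) : ∑ o, ternaryWeight lam o = 1 := by
  simp [Fintype.sum_option, ternaryWeight]
  ring

lemma ternaryWeight_nonneg {lam : ℝ} (h0 : 0 ≤ lam) (h1 : lam ≤ 1) (o : Option Bool) :
    0 ≤ ternaryWeight lam o := by
  cases o
  · simpa [ternaryWeight] using h1
  · simp [ternaryWeight]; linarith

lemma mixWeight_nonneg {lam : ℝ} (h0 : 0 ≤ lam) (h1 : lam ≤ 1) {n : ℕ}
    (w : Fin n → Fin n → Option Bool) : 0 ≤ mixWeight lam w :=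
  Finset.prod_nonneg fun _ _ => Finset.prod_nonneg fun _ _ => ternaryWeight_nonneg h0 h1 _

lemma cexp_pairSum {n : ℕ} (w : Fin n → Fin n → ℝ) :
    Complex.exp (Complex.I * (pairSum w : ℝ))
      = pairProd (fun i j => Complex.exp (Complex.I * (w i j : ℝ))) := by
  simp only [pairProd, pairSum, Complex.ofReal_sum, Finset.mul_sum, Complex.exp_sum]
  refine Finset.prod_congr rfl fun i _ => Finset.prod_congr rfl fun j _ => ?_
  split_ifs <;> simp

/-- A product of convex combinations of `1` and cosines is a positive mixture of characters. -/
lemma pairProd_cos_eq_sum (lam : ℝ) {n : ℕ} (θ : Fin n → Fin n → ℝ) :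
    ((pairProd fun i j => 1 - lam + lam * Real.cos (θ i j) : ℝ) : ℂ)
      = ∑ w, (mixWeight lam w : ℂ)
        * Complex.exp (Complex.I * (pairSum fun i j => ternary (w i j) * θ i j : ℝ)) := by
  have h := sum_prod_mul_pairProd (n := n) (fun o => (ternaryWeight lam o : ℂ))
    (by exact_mod_cast sum_ternaryWeight lam)
    fun i j o => Complex.exp (Complex.I * (ternary o * θ i j : ℝ))
  simp only [cexp_pairSum, mixWeight, Complex.ofReal_prod]
  rw [h]
  simp only [pairProd, Complex.ofReal_prod]
  refine Finset.prod_congr rfl fun i _ => Finset.prod_congr rfl fun j _ => ?_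
  split_ifs
  · simp only [Fintype.sum_option, Fintype.sum_bool, ternary, ternaryWeight, Option.elim,
      sgn_true, sgn_false]
    push_cast
    rw [Complex.cos]
    simp
    ring_nf
  · simp

/-- The exponent attached to one coordinate of the sign vectors of a red clique. -/
noncomputable def redExponent {n : ℕ} (η c : ℝ) (w : Fin n → Fin n → ℝ) (y : Fin n → Bool) : ℂ :=
  ((-η * quadForm (fun _ _ => 1) y : ℝ) : ℂ) + Complex.I * ((η / c * quadForm w y : ℝ) : ℂ)

lemma redExponent_re {n : ℕ} (η c : ℝ) (w : Fin n → Fin n → ℝ) (y : Fin n → Bool) :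
    (redExponent η c w y).re = -η * quadForm (fun _ _ => 1) y := by
  simp only [redExponent, Complex.add_re, Complex.ofReal_re, Complex.I_mul_re, Complex.ofReal_im]
  ring

lemma redExponent_im {n : ℕ} (η c : ℝ) (w : Fin n → Fin n → ℝ) (y : Fin n → Bool) :
    (redExponent η c w y).im = η / c * quadForm w y := by
  simp only [redExponent, Complex.add_im, Complex.ofReal_re, Complex.I_mul_im, Complex.ofReal_im]
  ring

/-- The mixture of characters turns the average over sign vectors into `d`-th powers of averages
over a single coordinate. -/
lemma expect_red_le_sum {n d : ℕ} {lam m s c : ℝ} (h0 : 0 ≤ lam) (h1 : lam ≤ 1) :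
    𝔼 x : Fin n → Fin d → Bool, Real.exp (-s * pairSum fun i j => corr m (x i) (x j))
        * pairProd (fun i j => 1 - lam + lam * Real.cos (s * corr m (x i) (x j) / c))
      ≤ ∑ w : Fin n → Fin n → Option Bool, mixWeight lam w
        * ‖𝔼 y, Complex.exp (redExponent (s / m) c (fun i j => ternary (w i j)) y)‖ ^ d := by
  have hx : ∀ x : Fin n → Fin d → Bool,
      ((Real.exp (-s * pairSum fun i j => corr m (x i) (x j))
        * pairProd (fun i j => 1 - lam + lam * Real.cos (s * corr m (x i) (x j) / c)) : ℝ) : ℂ)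
      = ∑ w : Fin n → Fin n → Option Bool, (mixWeight lam w : ℂ)
        * ∏ a, Complex.exp (redExponent (s / m) c (fun i j => ternary (w i j))
            fun i => x i a) := by
    intro x
    rw [Complex.ofReal_mul, pairProd_cos_eq_sum, Finset.mul_sum]
    refine Finset.sum_congr rfl fun w _ => ?_
    rw [mul_left_comm, Complex.ofReal_exp, ← Complex.exp_add, ← Complex.exp_sum]
    congr 2
    have e1 := pairSum_mul_corr m (fun _ _ => 1) x
    simp only [one_mul] at e1
    have e2 : (pairSum fun i j => ternary (w i j) * (s * corr m (x i) (x j) / c))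
        = ∑ a, s / m / c * quadForm (fun i j => ternary (w i j)) (fun i => x i a) := by
      have : (fun i j => ternary (w i j) * (s * corr m (x i) (x j) / c))
          = fun i j => s / c * (ternary (w i j) * corr m (x i) (x j)) := by
        ext i j; ring
      rw [this, pairSum_mul, pairSum_mul_corr, Finset.mul_sum]
      exact Finset.sum_congr rfl fun a _ => by ring
    simp only [redExponent, Finset.sum_add_distrib, ← Finset.mul_sum, ← Complex.ofReal_sum]
    rw [e1, e2, Finset.mul_sum, Finset.mul_sum]
    congr 3
    · ext a; ring
    · rw [Finset.mul_sum]
  refine (le_abs_self _).trans ?_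
  rw [← Real.norm_eq_abs, ← Complex.norm_real, Complex.ofReal_expect,
    expect_congr rfl fun x _ => hx x, expect_sum_comm]
  refine (norm_sum_le _ _).trans (Finset.sum_le_sum fun w _ => ?_)
  rw [← mul_expect, norm_mul, Complex.norm_real, Real.norm_of_nonneg (mixWeight_nonneg h0 h1 w),
    expect_prod_coord (g := fun y => Complex.exp
      (redExponent (s / m) c (fun i j => ternary (w i j)) y)), norm_pow]

lemma neg_quadForm_one_le {n : ℕ} (y : Fin n → Bool) : -quadForm (fun _ _ => 1) y ≤ n / 2 := by
  rw [quadForm_one]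
  have := sq_nonneg (linForm (fun _ => 1) y)
  linarith

lemma norm_expect_redExponent_le_trivial {n : ℕ} {η c : ℝ} (hη : 0 ≤ η)
    (w : Fin n → Fin n → ℝ) :
    ‖𝔼 y, Complex.exp (redExponent η c w y)‖ ≤ Real.exp (η * n / 2) := by
  refine (RCLike.norm_expect_le (K := ℂ)).trans (expect_le univ_nonempty fun y _ => ?_)
  rw [Complex.norm_exp, redExponent_re]
  have := mul_le_mul_of_nonneg_left (neg_quadForm_one_le y) hη
  exact Real.exp_le_exp.2 (by linarith)

/-- The main estimate for one coordinate: the first correction to the Gaussian approximation is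
the negative triangle term of order `η ^ 3 n ^ 3`. -/
lemma norm_expect_redExponent_le {n : ℕ} {η c : ℝ} (hη : 0 ≤ η) (hηn : η * n ≤ 2)
    (w : Fin n → Fin n → ℝ) {N e V : ℝ} (hN : N = n * (n - 1) / 2)
    (he : e = pairSum fun i j => w i j ^ 2) (hV : V = ∑ i, vertexSum w i ^ 2) :
    ‖𝔼 y, Complex.exp (redExponent η c w y)‖ ≤ Real.exp (η ^ 2 / 2 * (N - e / c ^ 2)
      - η ^ 3 / 6 * (n ^ 3 - 3 * n ^ 2 + 2 * n) + η ^ 3 / (2 * c ^ 2) * (V - 2 * e)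
      + 3240 * η ^ 4 * (N ^ 2 + e ^ 2 / c ^ 4)) := by
  set Q := quadForm (n := n) fun _ _ => 1
  have hQ2 : 𝔼 y, Q y ^ 2 = N := by
    rw [expect_quadForm_sq, pairSum_const, hN]; ring
  have hQ4 : 𝔼 y, Q y ^ 4 ≤ 81 * N ^ 2 := by
    have := expect_quadForm_pow_four_le (n := n) fun _ _ => 1
    rwa [pairSum_const, one_pow, one_mul, ← hN] at this
  have hQ3 := expect_quadForm_one_cube n
  have hw2 := expect_quadForm_sq w
  have hw4 := expect_quadForm_pow_four_le w
  have hQw := expect_quadForm_one_mul_sq w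
  rw [← he] at hw2 hw4 hQw
  rw [← hV] at hQw
  have h0 : 𝔼 y, redExponent η c w y = 0 := by
    apply Complex.ext
    · simp only [Complex.re_expect, redExponent_re, ← mul_expect, expect_quadForm]; simp
    · simp only [Complex.im_expect, redExponent_im, ← mul_expect, expect_quadForm]; simp
  have h1 : ∀ y, (redExponent η c w y).re ≤ 1 := fun y => by
    rw [redExponent_re]
    have := mul_le_mul_of_nonneg_left (neg_quadForm_one_le y) hη
    linarith
  refine (norm_expect_exp_le _ h0 h1).trans (Real.exp_le_exp.2 ?_)
  have hre2 : (𝔼 y, redExponent η c w y ^ 2).re = η ^ 2 * N - (η / c) ^ 2 * e := by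
    rw [Complex.re_expect, ← hQ2, ← hw2, mul_expect, mul_expect, ← expect_sub_distrib]
    refine expect_congr rfl fun y _ => ?_
    rw [sq, Complex.mul_re, redExponent_re, redExponent_im]; ring
  have hre3 : (𝔼 y, redExponent η c w y ^ 3).re
      = -η ^ 3 * (n ^ 3 - 3 * n ^ 2 + 2 * n) + 3 * η * (η / c) ^ 2 * (V - 2 * e) := by
    rw [Complex.re_expect, ← hQ3, ← hQw, mul_expect, mul_expect, ← expect_add_distrib]
    refine expect_congr rfl fun y _ => ?_
    rw [pow_succ, sq, Complex.mul_re, Complex.mul_re, Complex.mul_im, redExponent_re,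
      redExponent_im]; ring
  have h4 : 𝔼 y, ‖redExponent η c w y‖ ^ 4 ≤ 2 * η ^ 4 * (81 * N ^ 2)
      + 2 * (η / c) ^ 4 * (81 * e ^ 2) := by
    calc _ ≤ 𝔼 y, (2 * η ^ 4 * Q y ^ 4 + 2 * (η / c) ^ 4 * quadForm w y ^ 4) := by
          refine expect_le_expect fun y _ => ?_
          have e1 : ‖redExponent η c w y‖ ^ 4 = (‖redExponent η c w y‖ ^ 2) ^ 2 := by ring
          rw [e1, Complex.sq_norm, Complex.normSq_apply, redExponent_re, redExponent_im]
          nlinarith [sq_nonneg ((-η * Q y) ^ 2 - (η / c * quadForm w y) ^ 2)]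
      _ ≤ _ := by
          rw [expect_add_distrib, ← mul_expect, ← mul_expect]
          gcongr
  rw [hre2, hre3]
  have e1 : 20 * (2 * η ^ 4 * (81 * N ^ 2) + 2 * (η / c) ^ 4 * (81 * e ^ 2))
      = 3240 * η ^ 4 * (N ^ 2 + e ^ 2 / c ^ 4) := by
    rw [div_pow]; ring
  have e2 : (η ^ 2 * N - (η / c) ^ 2 * e) / 2 = η ^ 2 / 2 * (N - e / c ^ 2) := by
    rw [div_pow]; ring
  have e3 : (-η ^ 3 * (n ^ 3 - 3 * n ^ 2 + 2 * n) + 3 * η * (η / c) ^ 2 * (V - 2 * e)) / 6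
      = - η ^ 3 / 6 * (n ^ 3 - 3 * n ^ 2 + 2 * n) + η ^ 3 / (2 * c ^ 2) * (V - 2 * e) := by
    rw [div_pow, show η ^ 3 / (2 * c ^ 2) = η * (η ^ 2 / c ^ 2) / 2 by
      rw [mul_comm 2, ← div_div]; ring]
    ring
  rw [e2, e3]
  linarith

/-! ### Red cliques: large deviations of the mixture -/

lemma sum_mixWeight_exp_le {lam : ℝ} (h0 : 0 ≤ lam) (h1 : lam ≤ 1) {n : ℕ} (a : ℝ) :
    ∑ w : Fin n → Fin n → Option Bool, mixWeight lam w
        * Real.exp (a * pairSum fun i j => ternary (w i j) ^ 2)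
      ≤ Real.exp (lam * (Real.exp a - 1) * (n * (n - 1) / 2)) := by
  have h := sum_prod_mul_pairProd (n := n) (ternaryWeight lam) (sum_ternaryWeight lam)
    fun i j o => Real.exp (a * ternary o ^ 2)
  simp only [pairProd_exp, pairSum_mul] at h
  refine h.le.trans ?_
  rw [← pairSum_const, ← pairProd_exp]
  refine pairProd_mono (fun i j => Finset.sum_nonneg fun o _ =>
    mul_nonneg (ternaryWeight_nonneg h0 h1 o) (Real.exp_nonneg _)) fun i j => ?_
  simp only [Fintype.sum_option, Fintype.sum_bool, ternary, ternaryWeight, Option.elim, sgn_true,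
    sgn_false]
  norm_num
  have := Real.add_one_le_exp (lam * (Real.exp a - 1))
  linarith

lemma sum_sgn_mul_vertexSum {n : ℕ} (w : Fin n → Fin n → ℝ) (ε : Fin n → Bool) :
    ∑ i, sgn (ε i) * vertexSum w i = pairSum fun i j => w i j * (sgn (ε i) + sgn (ε j)) := by
  have h1 : ∀ i, sgn (ε i) * vertexSum w i
      = ∑ j, (if i < j then w i j * sgn (ε i) else 0)
        + ∑ j, (if j < i then w j i * sgn (ε i) else 0) := fun i => by
    rw [vertexSum, Finset.mul_sum, ← Finset.sum_add_distrib]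
    refine Finset.sum_congr rfl fun j _ => ?_
    rcases lt_trichotomy i j with h | h | h
    · simp [h, h.not_gt]; ring
    · simp [h]
    · simp [h, h.not_gt]; ring
  simp only [h1, Finset.sum_add_distrib, pairSum]
  rw [Finset.sum_comm (f := fun i j => if j < i then w j i * sgn (ε i) else 0),
    ← Finset.sum_add_distrib]
  refine Finset.sum_congr rfl fun i _ => ?_
  rw [← Finset.sum_add_distrib]
  refine Finset.sum_congr rfl fun j _ => ?_
  split_ifs
  · ring
  · simp

/-- The vertex sums of the random matrix are small on average, with Gaussian tails at scale
`n ^ 2`: the sum of their absolute values is a maximum over `2 ^ n` sign patterns. -/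
lemma sum_mixWeight_exp_vertexSum_le {lam : ℝ} (h0 : 0 ≤ lam) (h1 : lam ≤ 1) {n : ℕ} (θ : ℝ) :
    ∑ w : Fin n → Fin n → Option Bool, mixWeight lam w
        * Real.exp (θ * ∑ i, |vertexSum (fun i j => ternary (w i j)) i|)
      ≤ 2 ^ n * Real.exp (θ ^ 2 * n ^ 2) := by
  have habs : ∀ w : Fin n → Fin n → Option Bool,
      Real.exp (θ * ∑ i, |vertexSum (fun i j => ternary (w i j)) i|)
      ≤ ∑ ε : Fin n → Bool, Real.exp (pairSum fun i j =>
          θ * (ternary (w i j) * (sgn (ε i) + sgn (ε j)))) := by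
    intro w
    have e1 : ∀ ε : Fin n → Bool, Real.exp (pairSum fun i j =>
          θ * (ternary (w i j) * (sgn (ε i) + sgn (ε j))))
        = ∏ i, Real.exp (θ * (sgn (ε i) * vertexSum (fun i j => ternary (w i j)) i)) :=
      fun ε => by
        rw [pairSum_mul, ← sum_sgn_mul_vertexSum, Finset.mul_sum, Real.exp_sum]
    simp only [e1]
    have e2 := Finset.prod_univ_sum (fun _ : Fin n => (univ : Finset Bool))
      (fun i b => Real.exp (θ * (sgn b * vertexSum (fun i j => ternary (w i j)) i)))
    rw [Fintype.piFinset_univ] at e2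
    rw [← e2, Finset.mul_sum, Real.exp_sum]
    refine Finset.prod_le_prod (fun i _ => Real.exp_nonneg _) fun i _ => ?_
    rw [Fintype.sum_bool, sgn_true, sgn_false]
    rcases abs_choice (vertexSum (fun i j => ternary (w i j)) i) with h | h
    · rw [h, one_mul]; linarith [Real.exp_nonneg (θ * (-1 * vertexSum
        (fun i j => ternary (w i j)) i))]
    · rw [h, neg_one_mul]; linarith [Real.exp_nonneg (θ * (1 * vertexSum
        (fun i j => ternary (w i j)) i))]
  have hε : ∀ ε : Fin n → Bool, ∑ w : Fin n → Fin n → Option Bool, mixWeight lam w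
      * Real.exp (pairSum fun i j => θ * (ternary (w i j) * (sgn (ε i) + sgn (ε j))))
      ≤ Real.exp (θ ^ 2 * n ^ 2) := by
    intro ε
    have h := sum_prod_mul_pairProd (n := n) (ternaryWeight lam) (sum_ternaryWeight lam)
      fun i j o => Real.exp (θ * (ternary o * (sgn (ε i) + sgn (ε j))))
    simp only [pairProd_exp] at h
    refine h.le.trans ?_
    have hle : pairProd (fun i j : Fin n => ∑ o, ternaryWeight lam o
        * Real.exp (θ * (ternary o * (sgn (ε i) + sgn (ε j)))))
        ≤ pairProd (fun _ _ : Fin n => Real.exp (2 * θ ^ 2)) := by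
      refine pairProd_mono (fun i j => Finset.sum_nonneg fun o _ =>
        mul_nonneg (ternaryWeight_nonneg h0 h1 o) (Real.exp_nonneg _)) fun i j => ?_
      obtain ⟨a, ha⟩ : ∃ a, a = θ * (sgn (ε i) + sgn (ε j)) := ⟨_, rfl⟩
      have ha2 : a ^ 2 / 2 ≤ 2 * θ ^ 2 := by
        have : (sgn (ε i) + sgn (ε j)) ^ 2 ≤ 4 := by
          cases ε i <;> cases ε j <;> norm_num [sgn]
        rw [ha, mul_pow]
        nlinarith [sq_nonneg θ]
      simp only [Fintype.sum_option, Fintype.sum_bool, ternary, ternaryWeight, Option.elim,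
        sgn_true, sgn_false]
      have hc : Real.cosh a ≤ Real.exp (2 * θ ^ 2) :=
        (Real.cosh_le_exp_half_sq a).trans (Real.exp_le_exp.2 ha2)
      have hone : 1 ≤ Real.exp (2 * θ ^ 2) := Real.one_le_exp (by positivity)
      have e1 : θ * (1 * (sgn (ε i) + sgn (ε j))) = a := by rw [ha]; ring
      have e2 : θ * (-1 * (sgn (ε i) + sgn (ε j))) = -a := by rw [ha]; ring
      have e3 : θ * (0 * (sgn (ε i) + sgn (ε j))) = 0 := by ring
      rw [e1, e2, e3, Real.exp_zero]
      rw [Real.cosh_eq] at hc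
      nlinarith
    refine hle.trans ?_
    rw [pairProd_exp, pairSum_const]
    apply Real.exp_le_exp.2
    have hn : (0 : ℝ) ≤ n := n.cast_nonneg
    nlinarith [mul_nonneg (sq_nonneg θ) hn]
  calc _ ≤ ∑ w : Fin n → Fin n → Option Bool, mixWeight lam w * ∑ ε : Fin n → Bool,
        Real.exp (pairSum fun i j => θ * (ternary (w i j) * (sgn (ε i) + sgn (ε j)))) :=
        Finset.sum_le_sum fun w _ =>
          mul_le_mul_of_nonneg_left (habs w) (mixWeight_nonneg h0 h1 w)
    _ = ∑ ε : Fin n → Bool, ∑ w : Fin n → Fin n → Option Bool, mixWeight lam w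
        * Real.exp (pairSum fun i j => θ * (ternary (w i j) * (sgn (ε i) + sgn (ε j)))) := by
        simp only [Finset.mul_sum]; exact Finset.sum_comm
    _ ≤ ∑ ε : Fin n → Bool, Real.exp (θ ^ 2 * n ^ 2) := Finset.sum_le_sum fun ε _ => hε ε
    _ = _ := by simp

lemma abs_ternary_le (o : Option Bool) : |ternary o| ≤ 1 := by
  rcases o with _ | _ | _ <;> simp [ternary]

lemma abs_vertexSum_le {n : ℕ} (w : Fin n → Fin n → Option Bool) (i : Fin n) :
    |vertexSum (fun i j => ternary (w i j)) i| ≤ n := by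
  refine (Finset.abs_sum_le_sum_abs _ _).trans ?_
  have : ∀ j, |if i < j then ternary (w i j) else if j < i then ternary (w j i) else 0|
      ≤ (1 : ℝ) := fun j => by
    split_ifs
    exacts [abs_ternary_le _, abs_ternary_le _, by simp]
  refine (Finset.sum_le_sum fun j _ => this j).trans ?_
  simp

/-- The mixture bound: matrices with few nonzero entries and small vertex sums are treated by the
moment expansion, and the remaining ones are so unlikely that the trivial bound suffices. -/
lemma sum_mixWeight_norm_le {n m d : ℕ} (hd : d = m ^ 2) (hm : 0 < m) {lam s c x η N : ℝ}
    (h0 : 0 ≤ lam) (h1 : lam ≤ 1) (hc : 0 < c) (hlc : lam ≤ 2 * c ^ 2) (hs : 0 ≤ s)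
    (hη : η = s / m) (hηn : η * n ≤ 2) (hx : 0 ≤ x) (hN : N = n * (n - 1) / 2) :
    ∑ w : Fin n → Fin n → Option Bool, mixWeight lam w
        * ‖𝔼 y, Complex.exp (redExponent η c (fun i j => ternary (w i j)) y)‖ ^ d
      ≤ Real.exp (s ^ 2 * (N / 2 - η / 6 * (n ^ 3 - 3 * n ^ 2 + 2 * n) + η * x * n ^ 3 / (2 * c ^ 2)
          + 210600 * η ^ 2 * N ^ 2) + lam * (Real.exp (-(s ^ 2 / (2 * c ^ 2))) - 1) * N)
        + Real.exp (s * m * n / 2)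
          * (Real.exp (-(2 * lam * N)) + 2 ^ n * Real.exp (-(x ^ 2 * n ^ 2 / 4))) := by
  have hm' : (0 : ℝ) < m := by exact_mod_cast hm
  have hn' : (0 : ℝ) ≤ n := n.cast_nonneg
  have hη0 : 0 ≤ η := by rw [hη]; positivity
  have hmη : m * η = s := by rw [hη]; field_simp
  have hN0 : 0 ≤ N := by
    have := pairSum_const (n := n) 1
    rw [one_mul, ← hN] at this
    rw [← this]; exact pairSum_nonneg fun _ _ => zero_le_one
  set E := s ^ 2 * (N / 2 - η / 6 * (n ^ 3 - 3 * n ^ 2 + 2 * n) + η * x * n ^ 3 / (2 * c ^ 2)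
          + 210600 * η ^ 2 * N ^ 2) with hE
  set κ := s ^ 2 / (2 * c ^ 2) with hκ
  have hw : ∀ w : Fin n → Fin n → Option Bool,
      ‖𝔼 y, Complex.exp (redExponent η c (fun i j => ternary (w i j)) y)‖ ^ d
      ≤ Real.exp E * Real.exp (-κ * pairSum fun i j => ternary (w i j) ^ 2)
        + Real.exp (s * m * n / 2)
          * (Real.exp (-(4 * lam * N)) * Real.exp (1 * pairSum fun i j => ternary (w i j) ^ 2)
            + Real.exp (-(x ^ 2 * n ^ 2 / 2))
              * Real.exp (x / 2 * ∑ i, |vertexSum (fun i j => ternary (w i j)) i|)) := by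
    intro w
    obtain ⟨e, he⟩ : ∃ e, e = pairSum fun i j => ternary (w i j) ^ 2 := ⟨_, rfl⟩
    obtain ⟨R, hR⟩ : ∃ R, R = ∑ i, |vertexSum (fun i j => ternary (w i j)) i| := ⟨_, rfl⟩
    rw [← he, ← hR]
    have he0 : 0 ≤ e := he ▸ pairSum_nonneg fun i j => sq_nonneg _
    by_cases hgood : e ≤ 4 * lam * N ∧ R ≤ x * n ^ 2
    · obtain ⟨hg1, hg2⟩ := hgood
      refine le_trans ?_ (le_add_of_nonneg_right (by positivity))
      obtain ⟨V, hV⟩ : ∃ V, V = ∑ i, vertexSum (fun i j => ternary (w i j)) i ^ 2 := ⟨_, rfl⟩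
      have hVle : V ≤ x * n ^ 3 := by
        calc V ≤ ∑ i, n * |vertexSum (fun i j => ternary (w i j)) i| := by
              rw [hV]
              refine Finset.sum_le_sum fun i _ => ?_
              rw [← sq_abs, sq]
              exact mul_le_mul_of_nonneg_right (abs_vertexSum_le w i) (abs_nonneg _)
          _ = n * R := by rw [← Finset.mul_sum, hR]
          _ ≤ n * (x * n ^ 2) := by gcongr
          _ = _ := by ring
      have hec : e ^ 2 / c ^ 4 ≤ 64 * N ^ 2 := by
        have h2 : e ≤ 8 * c ^ 2 * N := by nlinarith
        rw [div_le_iff₀ (by positivity)]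
        calc e ^ 2 ≤ (8 * c ^ 2 * N) ^ 2 := by gcongr
          _ = _ := by ring
      have hmain := norm_expect_redExponent_le hη0 hηn (c := c)
        (fun i j => ternary (w i j)) hN he hV
      rw [← Real.exp_add]
      calc _ ≤ (Real.exp (η ^ 2 / 2 * (N - e / c ^ 2)
            - η ^ 3 / 6 * (n ^ 3 - 3 * n ^ 2 + 2 * n) + η ^ 3 / (2 * c ^ 2) * (V - 2 * e)
            + 3240 * η ^ 4 * (N ^ 2 + e ^ 2 / c ^ 4))) ^ d := by gcongr
        _ ≤ _ := by
          rw [← Real.exp_nat_mul, hd]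
          apply Real.exp_le_exp.2
          have hb : η ^ 2 / 2 * (N - e / c ^ 2)
            - η ^ 3 / 6 * (n ^ 3 - 3 * n ^ 2 + 2 * n) + η ^ 3 / (2 * c ^ 2) * (V - 2 * e)
            + 3240 * η ^ 4 * (N ^ 2 + e ^ 2 / c ^ 4)
            ≤ η ^ 2 / 2 * (N - e / c ^ 2)
            - η ^ 3 / 6 * (n ^ 3 - 3 * n ^ 2 + 2 * n) + η ^ 3 / (2 * c ^ 2) * (x * n ^ 3)
            + 3240 * η ^ 4 * (N ^ 2 + 64 * N ^ 2) := by
              gcongr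
              linarith
          refine (mul_le_mul_of_nonneg_left hb (by positivity)).trans (le_of_eq ?_)
          push_cast
          rw [hE, hκ, ← hmη]
          ring
    · refine le_trans ?_ (le_add_of_nonneg_left (by positivity))
      have h2 : 1 ≤ Real.exp (-(4 * lam * N)) * Real.exp (1 * e)
          + Real.exp (-(x ^ 2 * n ^ 2 / 2)) * Real.exp (x / 2 * R) := by
        rw [← Real.exp_add, ← Real.exp_add]
        rcases not_and_or.1 hgood with h | h
        · refine (Real.one_le_exp ?_).trans (le_add_of_nonneg_right (Real.exp_nonneg _))
          linarith
        · refine (Real.one_le_exp ?_).trans (le_add_of_nonneg_left (Real.exp_nonneg _))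
          have := mul_le_mul_of_nonneg_left (not_le.1 h).le (by positivity : 0 ≤ x / 2)
          linarith
      refine le_trans ?_ (le_mul_of_one_le_right (Real.exp_nonneg _) h2)
      calc _ ≤ (Real.exp (η * n / 2)) ^ d := by
            gcongr
            exact norm_expect_redExponent_le_trivial hη0 _
        _ = _ := by
            rw [← Real.exp_nat_mul, hd, ← hmη]
            push_cast
            ring_nf
  have hA := sum_mixWeight_exp_le h0 h1 (n := n) (-κ)
  have hB := sum_mixWeight_exp_le h0 h1 (n := n) 1
  have hC := sum_mixWeight_exp_vertexSum_le h0 h1 (n := n) (x / 2)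
  rw [← hN] at hA hB
  calc _ ≤ _ := Finset.sum_le_sum fun w _ =>
        mul_le_mul_of_nonneg_left (hw w) (mixWeight_nonneg h0 h1 w)
    _ = Real.exp E * ∑ w : Fin n → Fin n → Option Bool,
          mixWeight lam w * Real.exp (-κ * pairSum fun i j => ternary (w i j) ^ 2)
        + Real.exp (s * m * n / 2) * (Real.exp (-(4 * lam * N))
            * ∑ w : Fin n → Fin n → Option Bool,
              mixWeight lam w * Real.exp (1 * pairSum fun i j => ternary (w i j) ^ 2)
          + Real.exp (-(x ^ 2 * n ^ 2 / 2)) * ∑ w : Fin n → Fin n → Option Bool,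
              mixWeight lam w
                * Real.exp (x / 2 * ∑ i, |vertexSum (fun i j => ternary (w i j)) i|)) := by
        simp only [Finset.mul_sum, ← Finset.sum_add_distrib]
        exact Finset.sum_congr rfl fun w _ => by ring
    _ ≤ Real.exp E * Real.exp (lam * (Real.exp (-κ) - 1) * N)
        + Real.exp (s * m * n / 2) * (Real.exp (-(4 * lam * N))
            * Real.exp (lam * (Real.exp 1 - 1) * N)
          + Real.exp (-(x ^ 2 * n ^ 2 / 2)) * (2 ^ n * Real.exp ((x / 2) ^ 2 * n ^ 2))) := by
        gcongr
    _ ≤ _ := by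
        rw [← Real.exp_add, ← Real.exp_add, mul_left_comm, ← Real.exp_add]
        have h3 : lam * N * Real.exp 1 ≤ lam * N * 3 :=
          mul_le_mul_of_nonneg_left (by linarith [Real.exp_one_lt_d9]) (mul_nonneg h0 hN0)
        gcongr
        · linarith
        · apply le_of_eq; ring

/-- The probability of a red clique, before the parameters are chosen. -/
lemma expect_red_le {n m d : ℕ} (hd : d = m ^ 2) (hm : 0 < m) {p₀ p δ lam r s c x η N : ℝ}
    (hp₀ : 0 < p₀) (hp : p₀ ≤ p) (hp2 : p ≤ 1 / 2) (hδ : 0 < δ) (hδ1 : δ ≤ 1) (hc : 0 < c)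
    (hc2 : c ^ 2 = p₀ * δ ^ 2 / 288) (hr : r = p / (1 - p))
    (hlam : lam = (1 - δ) * c ^ 2 * (1 + r)) (hs : 0 ≤ s)
    (hη : η = s / m) (hηn : η * n ≤ 2) (hx : 0 ≤ x) (hN : N = n * (n - 1) / 2) :
    𝔼 x : Fin n → Fin d → Bool,
        pairProd (fun i j => 1 - min 1 ((1 - p) * Real.exp (r * s * corr m (x i) (x j))))
      ≤ Real.exp (Real.log p * N) * (Real.exp (s ^ 2 * (N / 2
            - η / 6 * (n ^ 3 - 3 * n ^ 2 + 2 * n) + η * x * n ^ 3 / (2 * c ^ 2)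
            + 210600 * η ^ 2 * N ^ 2) + lam * (Real.exp (-(s ^ 2 / (2 * c ^ 2))) - 1) * N)
          + Real.exp (s * m * n / 2)
            * (Real.exp (-(2 * lam * N)) + 2 ^ n * Real.exp (-(x ^ 2 * n ^ 2 / 4)))) := by
  have hppos : 0 < p := hp₀.trans_le hp
  have h1p : 0 < 1 - p := by linarith
  have hr0 : 0 < r := hr ▸ div_pos hppos h1p
  have hr1 : r ≤ 1 := by rw [hr, div_le_one h1p]; linarith
  have hl0 : 0 ≤ lam := by rw [hlam]; exact mul_nonneg (mul_nonneg (by linarith) (sq_nonneg _))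
                            (by linarith)
  have hl2 : lam ≤ 2 * c ^ 2 := by
    have h3 : (1 - δ) * (1 + r) ≤ 1 * 2 := by gcongr <;> linarith
    calc lam = (1 - δ) * (1 + r) * c ^ 2 := by rw [hlam]; ring
      _ ≤ 1 * 2 * c ^ 2 := by gcongr
      _ = _ := by ring
  have hc1 : c ^ 2 ≤ 1 / 4 := by
    have : p₀ * δ ^ 2 ≤ 1 * 1 ^ 2 := by gcongr; linarith
    rw [hc2]; linarith
  have hpt : ∀ x : Fin n → Fin d → Bool,
      pairProd (fun i j => 1 - min 1 ((1 - p) * Real.exp (r * s * corr m (x i) (x j))))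
      ≤ Real.exp (Real.log p * N) * (Real.exp (-s * pairSum fun i j => corr m (x i) (x j))
        * pairProd (fun i j => 1 - lam + lam * Real.cos (s * corr m (x i) (x j) / c))) := by
    intro x
    rw [hN, ← pairProd_const hppos, ← pairSum_mul, ← pairProd_exp, ← pairProd_mul,
      ← pairProd_mul]
    refine pairProd_mono (fun i j => sub_nonneg.2 (min_le_left _ _)) fun i j => ?_
    obtain ⟨z, hz⟩ : ∃ z, z = corr m (x i) (x j) := ⟨_, rfl⟩
    rw [← hz]
    have hkey := one_le_red_add_blue hp₀ hp hp2 hδ hδ1 hc hc2 (s * z)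
    rw [← hr, ← hlam] at hkey
    have hν : 0 ≤ 1 - lam + lam * Real.cos (s * z / c) := by
      have := mul_le_mul_of_nonneg_left (Real.neg_one_le_cos (s * z / c)) hl0
      linarith
    have hpos : 0 ≤ p * (Real.exp (-s * z) * (1 - lam + lam * Real.cos (s * z / c))) := by
      positivity
    rcases le_total 1 ((1 - p) * Real.exp (r * s * z)) with h | h
    · rw [min_eq_left h, sub_self]; exact hpos
    · rw [min_eq_right h]
      have e1 : -(s * z) = -s * z := by ring
      have e2 : r * (s * z) = r * s * z := by ring
      rw [e1, e2] at hkey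
      linarith
  refine (expect_le_expect fun x _ => hpt x).trans ?_
  rw [← mul_expect]
  refine mul_le_mul_of_nonneg_left ?_ (Real.exp_nonneg _)
  refine (expect_red_le_sum hl0 (by linarith)).trans ?_
  rw [← hη]
  exact sum_mixWeight_norm_le hd hm hl0 (by linarith) hc hl2 hs hη hηn hx hN

lemma exp_neg_sub_one_le {κ : ℝ} (hκ : 0 ≤ κ) : Real.exp (-κ) - 1 ≤ -κ + κ ^ 2 / 2 := by
  have h := Real.quadratic_le_exp_of_nonneg hκ
  rw [Real.exp_neg]
  have h2 : (Real.exp κ)⁻¹ ≤ (1 + κ + κ ^ 2 / 2)⁻¹ := by gcongr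
  have h3 : (1 + κ + κ ^ 2 / 2)⁻¹ ≤ 1 - κ + κ ^ 2 / 2 := by
    rw [inv_le_iff_one_le_mul₀ (by positivity)]
    have e : (1 - κ + κ ^ 2 / 2) * (1 + κ + κ ^ 2 / 2) = 1 + κ ^ 4 / 4 := by ring
    have := pow_nonneg hκ 4
    linarith
  linarith

set_option maxHeartbeats 1000000 in
/-- The probability of a red clique, to leading orders in the small parameters `s` and `τ`; the
term `-s ^ 2 * τ / 6` is the gain from triangles. -/
lemma expect_red_le_exp {n m d : ℕ} (hd : d = m ^ 2) {p₀ p r s c τ : ℝ}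
    (hp₀ : 0 < p₀) (hp : p₀ ≤ p) (hp2 : p ≤ 1 / 2) (hτ : 0 < τ) (hτ1 : τ ≤ 1 / 2) (hc : 0 < c)
    (hc2 : c ^ 2 = p₀ * (τ ^ 2) ^ 2 / 288) (hr : r = p / (1 - p)) (hs : 0 < s) (hs1 : s ≤ 1)
    (hsc : s ^ 2 * (1 / (2 * τ) + 1) ≤ c ^ 4 * τ ^ 2 / 4) (hm : m = ⌈s * n / τ⌉₊)
    (hn1 : 1 ≤ s * n) (hn2 : (4 - Real.log p) * n + 2 ≤ s ^ 2 * τ ^ 2 * n ^ 2) :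
    𝔼 x : Fin n → Fin d → Bool,
        pairProd (fun i j => 1 - min 1 ((1 - p) * Real.exp (r * s * corr m (x i) (x j))))
      ≤ Real.exp (n ^ 2 * (Real.log p / 2
          + s ^ 2 * (-(r / 4) - τ / 6 + 52653 * τ ^ 2))) := by
  have hppos : 0 < p := hp₀.trans_le hp
  have h1p : 0 < 1 - p := by linarith
  have hr0 : 0 < r := hr ▸ div_pos hppos h1p
  have hr1 : r ≤ 1 := by rw [hr, div_le_one h1p]; linarith
  have hn0 : (0 : ℝ) < n := pos_of_mul_pos_right (by linarith : 0 < s * n) hs.le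
  have hml : s * n / τ ≤ m := by rw [hm]; exact Nat.le_ceil _
  have hmu : (m : ℝ) ≤ s * n / τ + 1 := by
    rw [hm]; exact (Nat.ceil_lt_add_one (by positivity)).le
  have hm0' : (0 : ℝ) < m := lt_of_lt_of_le (by positivity) hml
  have hm0 : 0 < m := by exact_mod_cast hm0'
  obtain ⟨η, hη⟩ : ∃ η, η = s / m := ⟨_, rfl⟩
  have hη0 : 0 < η := by rw [hη]; positivity
  have hηu : η * n ≤ τ := by
    rw [div_le_iff₀ hτ] at hml
    rw [hη, div_mul_eq_mul_div, div_le_iff₀ hm0']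
    linarith
  have hηl : τ * (1 - τ) ≤ η * n := by
    rw [hη, div_mul_eq_mul_div, le_div_iff₀ hm0']
    have h2 : τ * (1 - τ) * m ≤ τ * (1 - τ) * (s * n / τ + 1) :=
      mul_le_mul_of_nonneg_left hmu (mul_nonneg hτ.le (by linarith))
    have h3 : τ * (1 - τ) * (s * n / τ + 1) = (1 - τ) * (s * n) + τ * (1 - τ) := by
      field_simp
    have h4 : τ * 1 ≤ τ * (s * n) := mul_le_mul_of_nonneg_left hn1 hτ.le
    have h5 := mul_pos hτ hτ
    linarith
  obtain ⟨N, hN⟩ : ∃ N : ℝ, N = n * (n - 1) / 2 := ⟨_, rfl⟩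
  have hn1' : (1 : ℝ) ≤ n := by
    have : 0 < n := by exact_mod_cast hn0
    exact_mod_cast this
  have hN0 : 0 ≤ N := by
    rw [hN]; exact div_nonneg (mul_nonneg hn0.le (by linarith)) zero_le_two
  have hNu : N ≤ n ^ 2 / 2 := by rw [hN]; linarith
  obtain ⟨lam, hlam⟩ : ∃ lam, lam = (1 - τ ^ 2) * c ^ 2 * (1 + r) := ⟨_, rfl⟩
  have hτ2 : τ ^ 2 ≤ 1 / 4 := by
    calc τ ^ 2 ≤ (1 / 2) ^ 2 := by gcongr
      _ = _ := by norm_num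
  have hcpos : 0 < c ^ 2 := by positivity
  have hc1 : c ^ 2 ≤ 1 / 4 := by
    have : p₀ * (τ ^ 2) ^ 2 ≤ 1 * 1 ^ 2 := by gcongr <;> linarith
    rw [hc2]; linarith
  have hlu : lam ≤ 2 * c ^ 2 := by
    have h3 : (1 - τ ^ 2) * (1 + r) ≤ 1 * 2 := by gcongr <;> linarith [sq_nonneg τ]
    calc lam = (1 - τ ^ 2) * (1 + r) * c ^ 2 := by rw [hlam]; ring
      _ ≤ 1 * 2 * c ^ 2 := by gcongr
      _ = _ := by ring
  have hll : c ^ 2 / 2 ≤ lam := by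
    have h3 : (1 / 2) * 1 ≤ (1 - τ ^ 2) * (1 + r) := by gcongr <;> linarith
    calc c ^ 2 / 2 = (1 / 2) * 1 * c ^ 2 := by ring
      _ ≤ (1 - τ ^ 2) * (1 + r) * c ^ 2 := by gcongr
      _ = _ := by rw [hlam]; ring
  have hs4 : s ^ 2 ≤ c ^ 4 * τ ^ 2 / 4 := by
    refine le_trans ?_ hsc
    have : 0 ≤ s ^ 2 * (1 / (2 * τ)) := by positivity
    linarith
  have hc4 : c ^ 4 * τ ^ 2 / 4 ≤ c ^ 2 / 2 := by
    have : c ^ 2 * (c ^ 2 * τ ^ 2) ≤ c ^ 2 * (1 / 4 * (1 / 4)) := by gcongr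
    have e : c ^ 4 * τ ^ 2 = c ^ 2 * (c ^ 2 * τ ^ 2) := by ring
    linarith
  have hlogp : Real.log p < 0 := Real.log_neg hppos (by linarith)
  have hmain := expect_red_le (n := n) hd hm0 hp₀ hp hp2 (δ := τ ^ 2) (by positivity)
    (by linarith) hc hc2 hr hlam hs.le hη (by linarith) (x := c ^ 2 * τ) (by positivity) hN
  refine hmain.trans ?_
  obtain ⟨T, hT⟩ : ∃ T, T = n ^ 2 * (Real.log p / 2
          + s ^ 2 * (-(r / 4) - τ / 6 + 52653 * τ ^ 2)) := ⟨_, rfl⟩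
  rw [← hT]
  have hlogN : Real.log p * N = n ^ 2 * (Real.log p / 2) - Real.log p / 2 * n := by
    rw [hN]; ring
  -- each of the three summands is at most a third of the claimed bound
  have hthird : ∀ a : ℝ, a ≤ T - 2 → Real.exp a ≤ Real.exp T / 3 := by
    intro a ha
    have h3 : (3 : ℝ) ≤ Real.exp 2 := by linarith [Real.add_one_le_exp (2 : ℝ)]
    rw [le_div_iff₀ (by norm_num)]
    calc Real.exp a * 3 ≤ Real.exp (T - 2) * Real.exp 2 := by gcongr
      _ = _ := by rw [← Real.exp_add]; ring_nf
  have hgood : Real.log p * N + (s ^ 2 * (N / 2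
      - η / 6 * (n ^ 3 - 3 * n ^ 2 + 2 * n) + η * (c ^ 2 * τ) * n ^ 3 / (2 * c ^ 2)
      + 210600 * η ^ 2 * N ^ 2) + lam * (Real.exp (-(s ^ 2 / (2 * c ^ 2))) - 1) * N) ≤ T - 2 := by
    obtain ⟨κ, hκ⟩ : ∃ κ, κ = s ^ 2 / (2 * c ^ 2) := ⟨_, rfl⟩
    have hκ0 : 0 ≤ κ := by rw [hκ]; positivity
    have hexp := exp_neg_sub_one_le hκ0
    have hlk : lam * κ = (1 - τ ^ 2) * (1 + r) * s ^ 2 / 2 := by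
      rw [hlam, hκ]; field_simp
    have hlk2 : lam * κ ^ 2 / 2 ≤ s ^ 2 * τ ^ 2 := by
      have h5 : lam * κ ^ 2 ≤ 2 * c ^ 2 * κ ^ 2 := by gcongr
      have h6 : 2 * c ^ 2 * κ ^ 2 = s ^ 2 * κ := by rw [hκ]; field_simp
      have h7 : κ ≤ τ ^ 2 := by
        rw [hκ, div_le_iff₀ (by positivity)]
        have : c ^ 2 * (c ^ 2 * τ ^ 2) ≤ 1 / 4 * (c ^ 2 * τ ^ 2) := by gcongr
        have e : c ^ 4 * τ ^ 2 = c ^ 2 * (c ^ 2 * τ ^ 2) := by ring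
        have : 0 ≤ c ^ 2 * τ ^ 2 := by positivity
        linarith
      have h8 : s ^ 2 * κ ≤ s ^ 2 * τ ^ 2 := by gcongr
      have : 0 ≤ s ^ 2 * τ ^ 2 := by positivity
      linarith
    have hlast : lam * (Real.exp (-κ) - 1) * N
        ≤ (-((1 - τ ^ 2) * (1 + r) * s ^ 2 / 2) + s ^ 2 * τ ^ 2) * N := by
      refine mul_le_mul_of_nonneg_right ?_ hN0
      have hl0 : 0 ≤ lam := by linarith
      have := mul_le_mul_of_nonneg_left hexp hl0
      linarith
    have hη3 : -(η / 6 * (n ^ 3 - 3 * n ^ 2 + 2 * n)) ≤ -(τ * n ^ 2 / 6) + τ ^ 2 * n ^ 2 / 6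
        + τ * n / 2 := by
      have h9 : τ * (1 - τ) * n ^ 2 ≤ η * n * n ^ 2 := by gcongr
      have h10 : η * n * n ≤ τ * n := by gcongr
      have h11 : 0 ≤ η * n := by positivity
      have e : η / 6 * ((n : ℝ) ^ 3 - 3 * n ^ 2 + 2 * n)
        = η * n * n ^ 2 / 6 - η * n * n / 2 + η * n / 3 := by ring
      rw [e]
      linarith
    have hη4 : η * (c ^ 2 * τ) * n ^ 3 / (2 * c ^ 2) ≤ τ ^ 2 * n ^ 2 / 2 := by
      have e : η * (c ^ 2 * τ) * n ^ 3 / (2 * c ^ 2) = τ * (η * n) * n ^ 2 / 2 := by field_simp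
      have : τ * (η * n) * n ^ 2 ≤ τ * τ * n ^ 2 := by gcongr
      rw [e]; linarith
    have hη5 : η ^ 2 * N ^ 2 ≤ τ ^ 2 * n ^ 2 / 4 := by
      calc η ^ 2 * N ^ 2 ≤ η ^ 2 * (n ^ 2 / 2) ^ 2 := by gcongr
        _ = (η * n) ^ 2 * n ^ 2 / 4 := by ring
        _ ≤ τ ^ 2 * n ^ 2 / 4 := by gcongr
    have hbr : N / 2 - η / 6 * (n ^ 3 - 3 * n ^ 2 + 2 * n)
        + η * (c ^ 2 * τ) * n ^ 3 / (2 * c ^ 2) + 210600 * η ^ 2 * N ^ 2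
        ≤ N / 2 + (-(τ * n ^ 2 / 6) + τ ^ 2 * n ^ 2 / 6 + τ * n / 2) + τ ^ 2 * n ^ 2 / 2
          + 52650 * (τ ^ 2 * n ^ 2) := by linarith
    have hbr2 := mul_le_mul_of_nonneg_left hbr (sq_nonneg s)
    -- the quadratic terms combine to `-r / 4`, up to the loss `τ ^ 2`
    have hNN : N / 2 - (1 - τ ^ 2) * (1 + r) / 2 * N + τ ^ 2 * N
        ≤ -(r / 4) * n ^ 2 + n / 4 + τ ^ 2 * n ^ 2 := by
      have h12 : τ ^ 2 * (1 + r) * N ≤ τ ^ 2 * 2 * N := by gcongr; linarith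
      have h13 : τ ^ 2 * N ≤ τ ^ 2 * (n ^ 2 / 2) := by gcongr
      have h14 : r * n ≤ 1 * n := by gcongr
      have e : N / 2 - (1 - τ ^ 2) * (1 + r) / 2 * N = -(r / 2) * N + τ ^ 2 * (1 + r) * N / 2 := by
        ring
      have e2 : -(r / 2) * N = -(r / 4) * n ^ 2 + r * n / 4 := by rw [hN]; ring
      rw [e, e2]
      linarith
    have hNN2 := mul_le_mul_of_nonneg_left hNN (sq_nonneg s)
    have hlin : s ^ 2 * (τ * n / 2 + n / 4) ≤ n := by
      have h15 : τ * n ≤ 1 * n := by gcongr; linarith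
      have h16 : s ^ 2 * (τ * n / 2 + n / 4) ≤ 1 ^ 2 * (τ * n / 2 + n / 4) := by gcongr
      linarith
    have hs2 : 0 ≤ s ^ 2 * τ ^ 2 * n ^ 2 := by positivity
    have hlp : Real.log p * n ≤ 0 := mul_nonpos_of_nonpos_of_nonneg hlogp.le hn0.le
    rw [hlogN, hT, ← hκ]
    linarith
  have hTlow : n ^ 2 * (Real.log p / 2) - s ^ 2 * n ^ 2 + s ^ 2 * τ ^ 2 * n ^ 2 ≤ T := by
    have h1 : 0 ≤ s ^ 2 * n ^ 2 := by positivity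
    have h2 : -1 + τ ^ 2 ≤ -(r / 4) - τ / 6 + 52653 * τ ^ 2 := by
      have := sq_nonneg τ
      linarith
    have := mul_le_mul_of_nonneg_left h2 h1
    rw [hT]
    linarith
  have hsm : s * m * n / 2 ≤ s ^ 2 * (1 / (2 * τ)) * n ^ 2 + n / 2 := by
    have h1 : s * m * n ≤ s * (s * n / τ + 1) * n := by gcongr
    have h2 : s * n ≤ 1 * n := by gcongr
    have e : s * (s * n / τ + 1) * n = 2 * (s ^ 2 * (1 / (2 * τ)) * n ^ 2) + s * n := by
      field_simp
    linarith
  have hscn : (s ^ 2 * (1 / (2 * τ)) + s ^ 2) * n ^ 2 ≤ c ^ 4 * τ ^ 2 / 4 * n ^ 2 := by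
    refine mul_le_mul_of_nonneg_right ?_ (by positivity)
    linarith
  have hlp : Real.log p * n ≤ 0 := mul_nonpos_of_nonpos_of_nonneg hlogp.le hn0.le
  have hbad1 : Real.log p * N + (s * m * n / 2 + -(2 * lam * N)) ≤ T - 2 := by
    have h1 : c ^ 4 * τ ^ 2 / 4 * n ^ 2 ≤ lam * n ^ 2 := by gcongr; linarith
    have e : 2 * lam * N = lam * n ^ 2 - lam * n := by rw [hN]; ring
    have h2 : lam * n ≤ 1 * n := by gcongr; linarith
    rw [hlogN]
    linarith
  have hbad2 : Real.log p * N + (s * m * n / 2 + (n + -((c ^ 2 * τ) ^ 2 * n ^ 2 / 4))) ≤ T - 2 := by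
    have e : (c ^ 2 * τ) ^ 2 * n ^ 2 / 4 = c ^ 4 * τ ^ 2 / 4 * n ^ 2 := by ring
    rw [hlogN, e]
    linarith
  have h2n : (2 : ℝ) ^ n ≤ Real.exp n := by
    have := Real.add_one_le_exp (1 : ℝ)
    calc (2 : ℝ) ^ n ≤ (Real.exp 1) ^ n := by gcongr; linarith
      _ = _ := by rw [← Real.exp_nat_mul, mul_one]
  have h1 := hthird _ hgood
  have h2 := hthird _ hbad1
  have h3 := hthird _ hbad2
  rw [Real.exp_add] at h1 h2 h3
  rw [Real.exp_add (s * m * n / 2)] at h2 h3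
  rw [Real.exp_add (n : ℝ)] at h3
  have h4 : Real.exp (Real.log p * N) * (Real.exp (s * m * n / 2)
      * (2 ^ n * Real.exp (-((c ^ 2 * τ) ^ 2 * n ^ 2 / 4))))
      ≤ Real.exp (Real.log p * N) * (Real.exp (s * m * n / 2)
      * (Real.exp n * Real.exp (-((c ^ 2 * τ) ^ 2 * n ^ 2 / 4)))) := by gcongr
  rw [mul_add (Real.exp (Real.log p * N)), mul_add (Real.exp (s * m * n / 2)),
    mul_add (Real.exp (Real.log p * N))]
  linarith

/-! ### The balanced density -/

/-- The left-hand side is strictly concave in `p` on `[0, 1 / 2]`, because its derivative is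
`1 - 2 * binEntropy p`, and it vanishes at both ends. -/
lemma sq_mul_log_lt {p : ℝ} (h0 : 0 < p) (h1 : p < 1 / 2) :
    0 < p ^ 2 * Real.log p - (1 - p) ^ 2 * Real.log (1 - p) := by
  set f : ℝ → ℝ := fun x => x ^ 2 * Real.log x - (1 - x) ^ 2 * Real.log (1 - x) with hf
  have hcont : Continuous f := by
    have h2 : Continuous fun x : ℝ => x * (x * Real.log x)
        - (1 - x) * ((1 - x) * Real.log (1 - x)) := by
      have h3 := Real.continuous_mul_log
      exact (continuous_id.mul h3).sub ((continuous_const.sub continuous_id).mul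
        (h3.comp (continuous_const.sub continuous_id)))
    convert h2 using 2 with x
    simp only [hf]; ring
  have hderiv : ∀ x ∈ Set.Ioo (0 : ℝ) (1 / 2), deriv f x = 1 - 2 * Real.binEntropy x := by
    intro x hx
    have hx1 : 1 - x ≠ 0 := by linarith [hx.2]
    have d1 := (hasDerivAt_pow 2 x).mul (Real.hasDerivAt_log hx.1.ne')
    have d0 : HasDerivAt (fun x : ℝ => 1 - x) (-1) x := by
      simpa using (hasDerivAt_id x).const_sub 1
    have d2 := (d0.pow 2).mul (d0.log hx1)
    have d := d1.sub d2
    rw [Real.binEntropy, Real.log_inv, Real.log_inv]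
    refine (HasDerivAt.congr_deriv d ?_).deriv
    have hx0 := hx.1.ne'
    simp only [Pi.pow_apply]
    field_simp
    ring
  have hconc : StrictConcaveOn ℝ (Set.Icc 0 (1 / 2)) f := by
    refine StrictAntiOn.strictConcaveOn_of_deriv (convex_Icc _ _) hcont.continuousOn ?_
    rw [interior_Icc]
    intro x hx y hy hxy
    rw [hderiv x hx, hderiv y hy]
    have := Real.binEntropy_strictMonoOn (a := x) (b := y)
      ⟨hx.1.le, by linarith [hx.2]⟩ ⟨hy.1.le, by linarith [hy.2]⟩ hxy
    linarith
  have h := hconc.2 (⟨le_rfl, by norm_num⟩ : (0 : ℝ) ∈ Set.Icc 0 (1 / 2))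
    (⟨by norm_num, le_rfl⟩ : (1 / 2 : ℝ) ∈ Set.Icc 0 (1 / 2)) (by norm_num)
    (by linarith : 0 < 1 - 2 * p) (by linarith : 0 < 2 * p) (by ring)
  have e0 : f 0 = 0 := by simp [hf]
  have e1 : f (1 / 2) = 0 := by simp only [hf]; norm_num
  rw [e0, e1] at h
  simp only [smul_eq_mul, mul_zero, add_zero, zero_add] at h
  have e : 2 * p * (1 / 2) = p := by ring
  rwa [e] at h

lemma eq_log_div_log_iff {C p : ℝ} (h0 : 0 < p) (h1 : p < 1 / 2) :
    C = Real.log p / Real.log (1 - p) ↔ Real.log p = C * Real.log (1 - p) := by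
  have h : Real.log (1 - p) ≠ 0 := (Real.log_neg (by linarith) (by linarith)).ne
  rw [eq_div_iff h, eq_comm]

/-- Existence and uniqueness of the density at which the two first moment conditions for the
uniform random graph agree. The last inequality is what makes the red gain from triangles outweigh
the blue loss. -/
lemma exists_balanced_density {C : ℝ} (hC : 1 < C) :
    ∃ p ∈ Set.Ioo (0 : ℝ) (1 / 2), Real.log p = C * Real.log (1 - p) ∧
      (∀ q ∈ Set.Ioo (0 : ℝ) (1 / 2), Real.log q = C * Real.log (1 - q) → q = p) ∧
      C * p ^ 2 < (1 - p) ^ 2 := by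
  have hmono : StrictMonoOn (fun x : ℝ => Real.log x - C * Real.log (1 - x))
      (Set.Ioo 0 1) := by
    intro x hx y hy hxy
    have h1 := Real.log_lt_log hx.1 hxy
    have h2 := Real.log_lt_log (by linarith [hy.2] : 0 < 1 - y) (by linarith : 1 - y < 1 - x)
    have := mul_lt_mul_of_pos_left h2 (by linarith : 0 < C)
    dsimp only
    linarith
  set a := Real.exp (-(C * Real.log 2)) / 2
  have hl2 : 0 < Real.log 2 := Real.log_pos one_lt_two
  have ha0 : 0 < a := by positivity
  have ha1 : a < 1 / 2 := by
    have : Real.exp (-(C * Real.log 2)) < 1 := Real.exp_lt_one_iff.2 (by nlinarith)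
    simp only [a]; linarith
  have hcont : ContinuousOn (fun x : ℝ => Real.log x - C * Real.log (1 - x))
      (Set.Icc a (1 / 2)) := by
    refine ContinuousOn.sub (ContinuousOn.log continuousOn_id fun x hx => ?_)
      (continuousOn_const.mul (ContinuousOn.log (by fun_prop) fun x hx => ?_))
    · exact (ha0.trans_le hx.1).ne'
    · have := hx.2; linarith
  have hhalf : Real.log (1 / 2) = -Real.log 2 := by rw [one_div, Real.log_inv]
  have hfa : Real.log a - C * Real.log (1 - a) < 0 := by
    have h1 : Real.log a = -(C * Real.log 2) - Real.log 2 := by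
      simp only [a]
      rw [Real.log_div (Real.exp_pos _).ne' two_ne_zero, Real.log_exp]
    have h2 : -Real.log 2 ≤ Real.log (1 - a) := by
      rw [← hhalf]; exact Real.log_le_log (by norm_num) (by linarith)
    have := mul_le_mul_of_nonneg_left h2 (by linarith : 0 ≤ C)
    linarith
  have hfh : 0 < Real.log (1 / 2) - C * Real.log (1 - 1 / 2) := by
    have e : (1 : ℝ) - 1 / 2 = 1 / 2 := by norm_num
    rw [e, hhalf]; nlinarith
  obtain ⟨p, hp, hp0⟩ := intermediate_value_Ioo ha1.le hcont ⟨hfa, hfh⟩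
  have hpm : p ∈ Set.Ioo (0 : ℝ) (1 / 2) := ⟨ha0.trans hp.1, hp.2⟩
  refine ⟨p, hpm, by linarith [hp0], fun q hq hq0 => ?_, ?_⟩
  · refine hmono.injOn ⟨hq.1, by linarith [hq.2]⟩ ⟨hpm.1, by linarith [hpm.2]⟩ ?_
    dsimp only at hp0 ⊢
    rw [hp0]; linarith
  · have h := sq_mul_log_lt hpm.1 hpm.2
    have e : Real.log p = C * Real.log (1 - p) := by linarith [hp0]
    have hneg : Real.log (1 - p) < 0 := Real.log_neg (by linarith [hpm.2]) (by linarith [hpm.1])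
    rw [e] at h
    have h2 : 0 < ((1 - p) ^ 2 - C * p ^ 2) * -Real.log (1 - p) := by linarith
    have := pos_of_mul_pos_left h2 (by linarith)
    linarith

/-! ### Choice of the parameters -/

lemma eventually_linear_le_sq {a : ℝ} (ha : 0 < a) (b c : ℝ) :
    ∀ᶠ n : ℕ in Filter.atTop, b * n + c ≤ a * (n : ℝ) ^ 2 := by
  filter_upwards [Filter.eventually_ge_atTop (⌈(|b| + |c|) / a⌉₊ + 1)] with n hn
  have h1 : (|b| + |c|) / a ≤ n :=
    (Nat.le_ceil _).trans (by exact_mod_cast (Nat.le_succ _).trans hn)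
  have h2 : (1 : ℝ) ≤ n := by exact_mod_cast (Nat.le_add_left 1 _).trans hn
  rw [div_le_iff₀ ha] at h1
  have h3 : (|b| + |c|) * n ≤ n * a * n := by gcongr
  have h4 : b * n ≤ |b| * n := by gcongr; exact le_abs_self b
  have h5 : |c| * 1 ≤ |c| * n := by gcongr
  have h6 := le_abs_self c
  linarith

lemma exp_neg_lt_half {x : ℝ} (hx : x ≤ -1) : Real.exp x < 1 / 2 := by
  have h1 : Real.exp x ≤ Real.exp (-1) := Real.exp_le_exp.2 hx
  linarith [Real.exp_neg_one_lt_half]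

lemma pow_floor_exp_le {x : ℝ} (k : ℕ) : ((⌊Real.exp x⌋₊ : ℕ) : ℝ) ^ k ≤ Real.exp (k * x) := by
  rw [Real.exp_nat_mul]
  gcongr
  exact Nat.floor_le (Real.exp_nonneg x)

set_option maxHeartbeats 2000000 in
/-- The exponential improvement in terms of the balanced density `P`. The density `p` of the red
edges is a little larger than `P`: the term `P ^ 2 / (2 * (1 - P)) * s ^ 2` recentres the tilted
edge probabilities, and the remaining one shares the gain from triangles between the colours. -/
theorem exists_not_ramseyProperty {C P : ℝ} (hC : 1 < C) (hP : P ∈ Set.Ioo (0 : ℝ) (1 / 2))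
    (hbal : Real.log P = C * Real.log (1 - P)) (hgap : C * P ^ 2 < (1 - P) ^ 2) :
    ∃ ω : ℝ, 0 < ω ∧ ∀ᶠ ℓ : ℕ in Filter.atTop,
      ¬ RamseyProperty ℓ ⌊C * (ℓ : ℝ)⌋₊ ⌊Real.exp (ℓ * (-(Real.log P / 2) + ω))⌋₊ := by
  obtain ⟨hP0, hP1⟩ := hP
  have h1P : 0 < 1 - P := by linarith
  obtain ⟨r₀, hr₀⟩ : ∃ r, r = P / (1 - P) := ⟨_, rfl⟩
  have hr₀0 : 0 < r₀ := hr₀ ▸ div_pos hP0 h1P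
  have hr₀1 : r₀ ≤ 1 := by rw [hr₀, div_le_one h1P]; linarith
  have hr₀P : r₀ * (1 - P) = P := by rw [hr₀]; field_simp
  obtain ⟨A, hA⟩ : ∃ A, A = r₀ ^ 2 * C := ⟨_, rfl⟩
  have hA0 : 0 < A := by rw [hA]; positivity
  have hA1 : A < 1 := by
    rw [hA, hr₀, div_pow, div_mul_eq_mul_div, div_lt_one (by positivity)]
    linarith
  -- measured by the change of `P` they are worth, the red gain and the blue loss from triangles
  -- have the ratio `1 : A`; each colour keeps half `g` of the surplus `(1 - A) / 6`
  obtain ⟨g, hg⟩ : ∃ g, g = (1 - A) / 12 := ⟨_, rfl⟩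
  have hg0 : 0 < g := by rw [hg]; linarith
  have hg1 : g ≤ 1 := by rw [hg]; linarith
  obtain ⟨τ, hτ⟩ : ∃ τ, τ = r₀ * g / (300000 * C ^ 2) := ⟨_, rfl⟩
  have hC2 : 1 ≤ C ^ 2 := by nlinarith
  have hτ0 : 0 < τ := by rw [hτ]; positivity
  have hτC : τ * C ^ 2 = r₀ * g / 300000 := by rw [hτ]; field_simp
  have hrg : r₀ * g ≤ 1 * g := by gcongr
  have hrg0 : 0 < r₀ * g := by positivity
  have hτle : τ ≤ τ * C ^ 2 := le_mul_of_one_le_right hτ0.le hC2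
  have hτle2 : τ * C ≤ τ * C ^ 2 := by gcongr; nlinarith
  obtain ⟨c, hc⟩ : ∃ c, c = Real.sqrt (P * (τ ^ 2) ^ 2 / 288) := ⟨_, rfl⟩
  have hc0 : 0 < c := by rw [hc]; positivity
  have hc2 : c ^ 2 = P * (τ ^ 2) ^ 2 / 288 := by rw [hc, Real.sq_sqrt (by positivity)]
  obtain ⟨s, hs0, hs1, hsa, hsb, hsc⟩ : ∃ s : ℝ, 0 < s ∧ s ≤ 1 ∧
      s ^ 2 * (1 / (2 * τ) + 1) ≤ c ^ 4 * τ ^ 2 / 4 ∧ s ^ 2 ≤ 1 / 2 - P ∧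
      s ^ 2 * (2 + 2 * C) ≤ τ * (r₀ * g) / 4 := by
    set K := min (c ^ 4 * τ ^ 2 / 4 / (1 / (2 * τ) + 1))
      (min (1 / 2 - P) (τ * (r₀ * g) / 4 / (2 + 2 * C))) with hK
    have hK0 : 0 < K := lt_min (by positivity) (lt_min (by linarith) (by positivity))
    have hs : (min 1 K) ^ 2 ≤ K := by
      have h0 : 0 < min 1 K := lt_min one_pos hK0
      calc (min 1 K) ^ 2 = min 1 K * min 1 K := sq _
        _ ≤ 1 * K := mul_le_mul (min_le_left _ _) (min_le_right _ _) h0.le zero_le_one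
        _ = K := one_mul K
    refine ⟨min 1 K, lt_min one_pos hK0, min_le_left _ _, ?_, ?_, ?_⟩
    · rw [← le_div_iff₀ (by positivity)]; exact hs.trans (min_le_left _ _)
    · exact hs.trans ((min_le_right _ _).trans (min_le_left _ _))
    · rw [← le_div_iff₀ (by positivity)]
      exact hs.trans ((min_le_right _ _).trans (min_le_right _ _))
  have hs2 : 0 < s ^ 2 := by positivity
  obtain ⟨μ, hμ⟩ : ∃ μ, μ = P * (1 + A) / 6 := ⟨_, rfl⟩
  have hμ0 : 0 < μ := by rw [hμ]; positivity
  obtain ⟨ξ, hξ⟩ : ∃ ξ, ξ = s ^ 2 * (P * r₀ / 2 + μ * τ) := ⟨_, rfl⟩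
  have hξ0 : 0 < ξ := by rw [hξ]; positivity
  have hτhalf : τ ≤ 1 / 2 := by linarith
  have hξs : ξ ≤ s ^ 2 := by
    have h1 : P * r₀ ≤ 1 / 2 * 1 := by gcongr
    have h2 : μ * τ ≤ 1 / 6 * 1 := by
      have : μ ≤ 1 / 6 := by
        have : P * (1 + A) ≤ 1 / 2 * 2 := by gcongr; linarith
        rw [hμ]; linarith
      gcongr; linarith
    rw [hξ]
    exact mul_le_of_le_one_right hs2.le (by linarith)
  obtain ⟨p, hp⟩ : ∃ p, p = P + ξ := ⟨_, rfl⟩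
  have hPp : P ≤ p := by linarith
  have hp0 : 0 < p := hP0.trans_le hPp
  have hp2 : p ≤ 1 / 2 := by linarith
  have h1p : 0 < 1 - p := by linarith
  obtain ⟨r, hr⟩ : ∃ r, r = p / (1 - p) := ⟨_, rfl⟩
  have hr0 : 0 < r := hr ▸ div_pos hp0 h1p
  have hr1 : r ≤ 1 := by rw [hr, div_le_one h1p]; linarith
  have hrr₀ : r₀ ≤ r := by
    rw [hr, hr₀, div_le_div_iff₀ h1P h1p]; linarith
  have hrdiff : r - r₀ ≤ 4 * s ^ 2 := by
    have e : r - r₀ = ξ / ((1 - p) * (1 - P)) := by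
      rw [hr, hr₀, hp]
      have : 1 - (P + ξ) ≠ 0 := by rw [← hp]; exact h1p.ne'
      field_simp
      ring
    have h4 : 1 / 2 * (1 / 2) ≤ (1 - p) * (1 - P) := by gcongr <;> linarith
    rw [e, div_le_iff₀ (by positivity)]
    have : 4 * s ^ 2 * (1 / 2 * (1 / 2)) ≤ 4 * s ^ 2 * ((1 - p) * (1 - P)) := by gcongr
    linarith
  obtain ⟨ω, hω⟩ : ∃ ω, ω = s ^ 2 * τ * (r₀ * g) / 8 := ⟨_, rfl⟩
  have hω0 : 0 < ω := by rw [hω]; positivity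
  obtain ⟨Λ, hΛ⟩ : ∃ Λ, Λ = -(Real.log P / 2) + ω := ⟨_, rfl⟩
  refine ⟨ω, hω0, ?_⟩
  rw [← hΛ]
  -- the exponents of the expected numbers of red and blue cliques are negative
  have hred : Λ + (Real.log p / 2 + s ^ 2 * (-(r / 4) - τ / 6 + 52653 * τ ^ 2))
      ≤ -(s ^ 2 * τ * g / 2) := by
    have h1 : Real.log p - Real.log P ≤ ξ / P := by
      rw [← Real.log_div hp0.ne' hP0.ne']
      refine (Real.log_le_sub_one_of_pos (by positivity)).trans (le_of_eq ?_)
      rw [hp]; field_simp; ring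
    have h2 : ξ / P = s ^ 2 * (r₀ / 2 + (1 + A) / 6 * τ) := by
      rw [hξ, hμ]; field_simp
    have h3 : s ^ 2 * (-(r / 4) - τ / 6 + 52653 * τ ^ 2)
        ≤ s ^ 2 * (-(r₀ / 4) - τ / 6 + 52653 * τ ^ 2) := by gcongr
    have h4 : 52653 * τ ≤ g / 4 := by linarith
    have h5 : s ^ 2 * τ * (52653 * τ) ≤ s ^ 2 * τ * (g / 4) := by gcongr
    have h6 : s ^ 2 * τ * (r₀ * g) ≤ s ^ 2 * τ * (1 * g) := by gcongr
    have h7 : s ^ 2 * τ * A = s ^ 2 * τ * (1 - 12 * g) := by rw [hg]; ring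
    have h8 : 0 < s ^ 2 * τ * g := by positivity
    rw [hΛ]
    linarith
  have hblue : Λ / C + (Real.log (1 - p) / 2 + s ^ 2 * (r ^ 2 / 4 + r ^ 3 * C * τ / 6
      + C ^ 2 * τ ^ 2)) ≤ -(s ^ 2 * τ * (r₀ * g) / 4) := by
    have h0 : Λ / C ≤ -(Real.log (1 - P) / 2) + ω := by
      rw [hΛ, hbal, div_le_iff₀ (by linarith)]
      have := mul_le_mul_of_nonneg_left hC.le hω0.le
      linarith
    have h1 : Real.log (1 - p) - Real.log (1 - P) ≤ -(ξ / (1 - P)) := by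
      rw [← Real.log_div h1p.ne' h1P.ne']
      refine (Real.log_le_sub_one_of_pos (by positivity)).trans (le_of_eq ?_)
      rw [hp]; field_simp; ring
    have h2 : ξ / (1 - P) = s ^ 2 * (r₀ ^ 2 / 2 + r₀ * (1 + A) / 6 * τ) := by
      rw [div_eq_iff h1P.ne', hξ, hμ]
      linear_combination s ^ 2 * (-(r₀ / 2) - (1 + A) / 6 * τ) * hr₀P
    have h3 : r ^ 2 - r₀ ^ 2 ≤ 8 * s ^ 2 := by
      have : (r - r₀) * (r + r₀) ≤ 4 * s ^ 2 * 2 := by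
        gcongr
        linarith
      linarith
    have h4 : r ^ 3 - r₀ ^ 3 ≤ 12 * s ^ 2 := by
      have h5 : r ^ 2 + r * r₀ + r₀ ^ 2 ≤ 3 := by
        have a1 : r ^ 2 ≤ 1 := pow_le_one₀ hr0.le hr1
        have a2 : r₀ ^ 2 ≤ 1 := pow_le_one₀ hr₀0.le hr₀1
        have a3 : r * r₀ ≤ 1 := mul_le_one₀ hr1 hr₀0.le hr₀1
        linarith
      have : (r - r₀) * (r ^ 2 + r * r₀ + r₀ ^ 2) ≤ 4 * s ^ 2 * 3 := by gcongr
      linarith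
    have h6 : (r ^ 3 - r₀ ^ 3) * (C * τ) ≤ 12 * s ^ 2 * (C * 1) := by
      gcongr
      linarith
    have h7 : r₀ ^ 3 * C = r₀ * A := by rw [hA]; ring
    have h8 : C ^ 2 * τ ^ 2 ≤ τ * (r₀ * g / 8) := by
      have e : C ^ 2 * τ ^ 2 = τ * (τ * C ^ 2) := by ring
      rw [e, hτC]; gcongr; norm_num
    have h9 : r ^ 2 / 4 + r ^ 3 * C * τ / 6 + C ^ 2 * τ ^ 2
        ≤ r₀ ^ 2 / 4 + r₀ * A * τ / 6 + s ^ 2 * (2 + 2 * C) + τ * (r₀ * g / 8) := by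
      have e : r₀ ^ 3 * C * τ = r₀ * A * τ := by rw [h7]
      linarith
    have h10 := mul_le_mul_of_nonneg_left (h9.trans (add_le_add_left (add_le_add_right hsc _) _))
      hs2.le
    have h11 : s ^ 2 * τ * r₀ * A = s ^ 2 * τ * r₀ * (1 - 12 * g) := by rw [hg]; ring
    linarith
  have hfloor : Filter.Tendsto (fun ℓ : ℕ => ⌊C * (ℓ : ℝ)⌋₊) Filter.atTop Filter.atTop := by
    refine Filter.tendsto_atTop_mono (fun ℓ => ?_) Filter.tendsto_id
    exact Nat.le_floor (le_mul_of_one_le_left ℓ.cast_nonneg hC.le)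
  have ha1 : 0 < s ^ 2 * τ * g / 2 := by positivity
  have ha2 : 0 < s ^ 2 * τ * (r₀ * g) / 4 := by positivity
  have hsℓ : ∀ᶠ ℓ : ℕ in Filter.atTop, 1 ≤ s * ℓ := by
    filter_upwards [Filter.eventually_ge_atTop ⌈1 / s⌉₊] with ℓ hℓ
    have := (Nat.le_ceil (1 / s)).trans (by exact_mod_cast hℓ : (⌈1 / s⌉₊ : ℝ) ≤ ℓ)
    rw [div_le_iff₀ hs0] at this
    linarith
  filter_upwards [hsℓ, eventually_linear_le_sq (by positivity : 0 < s ^ 2 * τ ^ 2)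
      (4 - Real.log p) 2, eventually_linear_le_sq ha1 0 1,
    hfloor.eventually (eventually_linear_le_sq ha2 (Λ / C - Real.log (1 - p) / 2) 1)]
    with ℓ hℓ1 hℓ2 hℓ3 hℓ4
  obtain ⟨k, hk⟩ : ∃ k, k = ⌊C * (ℓ : ℝ)⌋₊ := ⟨_, rfl⟩
  rw [← hk] at hℓ4 ⊢
  obtain ⟨m, hm⟩ : ∃ m, m = ⌈s * ℓ / τ⌉₊ := ⟨_, rfl⟩
  have hℓ0 : (0 : ℝ) < ℓ := pos_of_mul_pos_right (by linarith : 0 < s * ℓ) hs0.le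
  have hml : s * ℓ / τ ≤ m := by rw [hm]; exact Nat.le_ceil _
  have hm0' : (0 : ℝ) < m := lt_of_lt_of_le (by positivity) hml
  have hm0 : 0 < m := by exact_mod_cast hm0'
  have hkC : (k : ℝ) ≤ C * ℓ := by rw [hk]; exact Nat.floor_le (by positivity)
  have hkC2 : C * ℓ ≤ k + 1 := by rw [hk]; exact (Nat.lt_floor_add_one _).le
  have hk0 : (0 : ℝ) ≤ k := k.cast_nonneg
  have hΛ0 : 0 < Λ := by
    have := Real.log_neg hP0 (by linarith)
    rw [hΛ]; linarith
  obtain ⟨σ, hσ⟩ : ∃ σ, σ = r * s * k / m := ⟨_, rfl⟩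
  have hσ0 : 0 ≤ σ := by rw [hσ]; positivity
  have hmσ : m * σ = r * s * k := by rw [hσ]; field_simp
  have hσr : σ ≤ r * (C * τ) := by
    rw [div_le_iff₀ hτ0] at hml
    rw [hσ, div_le_iff₀ hm0']
    calc r * s * k ≤ r * s * (C * ℓ) := by gcongr
      _ = r * C * (s * ℓ) := by ring
      _ ≤ r * C * (m * τ) := by gcongr
      _ = _ := by ring
  have hCτ : 0 ≤ C * τ := by positivity
  have hσC : σ ≤ C * τ := hσr.trans (mul_le_of_le_one_left hCτ hr1)
  have hR := expect_red_le_exp (n := ℓ) (m := m) (d := m ^ 2) rfl hP0 hPp hp2 hτ0 hτhalf hc0 hc2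
    hr hs0 hs1 hsa hm hℓ1 hℓ2
  have hB := expect_blue_le (k := k) (m := m) (d := m ^ 2) rfl hm0 h1p (t := r * s) (by positivity)
    hσ (by linarith)
  refine not_ramseyProperty_of_types (Ω := Fin (m ^ 2) → Bool)
    (fun u v => min 1 ((1 - p) * Real.exp (r * s * corr m u v)))
    (fun u v => by rw [corr_comm]) (fun u v => by positivity) (fun u v => min_le_left _ _) ?_
  have hRed : ((⌊Real.exp (ℓ * Λ)⌋₊ : ℕ) : ℝ) ^ ℓ * 𝔼 x : Fin ℓ → Fin (m ^ 2) → Bool,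
      pairProd (fun i j => 1 - min 1 ((1 - p) * Real.exp (r * s * corr m (x i) (x j))))
        < 1 / 2 := by
    calc _ ≤ Real.exp (ℓ * (ℓ * Λ)) * Real.exp (ℓ ^ 2 * (Real.log p / 2
          + s ^ 2 * (-(r / 4) - τ / 6 + 52653 * τ ^ 2))) :=
          mul_le_mul (pow_floor_exp_le ℓ) hR
            (expect_nonneg fun x _ => pairProd_nonneg fun i j => sub_nonneg.2 (min_le_left _ _))
            (Real.exp_nonneg _)
      _ < 1 / 2 := by
          rw [← Real.exp_add]
          refine exp_neg_lt_half ?_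
          have := mul_le_mul_of_nonneg_left hred (sq_nonneg (ℓ : ℝ))
          linarith
  have hBlue : ((⌊Real.exp (ℓ * Λ)⌋₊ : ℕ) : ℝ) ^ k * 𝔼 x : Fin k → Fin (m ^ 2) → Bool,
      pairProd (fun i j => min 1 ((1 - p) * Real.exp (r * s * corr m (x i) (x j)))) < 1 / 2 := by
    calc _ ≤ Real.exp (k * (ℓ * Λ)) * Real.exp (Real.log (1 - p) * (k * (k - 1) / 2)
          + m ^ 2 * (σ ^ 2 / 4 + σ ^ 3 / 6 + σ ^ 4)) :=
          mul_le_mul (pow_floor_exp_le k) hB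
            (expect_nonneg fun x _ => pairProd_nonneg fun i j => by positivity)
            (Real.exp_nonneg _)
      _ < 1 / 2 := by
          rw [← Real.exp_add]
          refine exp_neg_lt_half ?_
          have h1 : k * (ℓ * Λ) ≤ (k ^ 2 + k) * (Λ / C) := by
            have h2 : (ℓ : ℝ) ≤ (k + 1) / C := by
              rw [le_div_iff₀ (by linarith)]; linarith
            calc k * (ℓ * Λ) ≤ k * ((k + 1) / C * Λ) := by gcongr
              _ = _ := by ring
          have h3 : m ^ 2 * (σ ^ 2 / 4 + σ ^ 3 / 6 + σ ^ 4)
              ≤ k ^ 2 * (s ^ 2 * (r ^ 2 / 4 + r ^ 3 * C * τ / 6 + C ^ 2 * τ ^ 2)) := by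
            have e : m ^ 2 * (σ ^ 2 / 4 + σ ^ 3 / 6 + σ ^ 4)
                = k ^ 2 * (s ^ 2 * (r ^ 2 / 4 + r ^ 2 * σ / 6 + r ^ 2 * σ ^ 2)) := by
              linear_combination (m * σ + r * s * k) * (1 / 4 + σ / 6 + σ ^ 2) * hmσ
            have h4 : r ^ 2 * σ ≤ r ^ 2 * (r * (C * τ)) := by gcongr
            have h5 : r ^ 2 * σ ^ 2 ≤ 1 * (C * τ) ^ 2 := by
              gcongr
              exact pow_le_one₀ hr0.le hr1
            rw [e]
            have h6 : r ^ 2 / 4 + r ^ 2 * σ / 6 + r ^ 2 * σ ^ 2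
                ≤ r ^ 2 / 4 + r ^ 3 * C * τ / 6 + C ^ 2 * τ ^ 2 := by
              linarith
            gcongr
          have := mul_le_mul_of_nonneg_left hblue (sq_nonneg (k : ℝ))
          linarith
  linarith

end RamseyLower


theorem theorem1 (C : ℝ) (hC : 1 < C) :
    ∃ p : ℝ,
      -- `p` is the unique solution of the equation in `(0, 1/2)`
      (p ∈ Set.Ioo (0 : ℝ) (1 / 2) ∧ C = Real.log p / Real.log (1 - p)) ∧
      (∀ q ∈ Set.Ioo (0 : ℝ) (1 / 2), C = Real.log q / Real.log (1 - q) → q = p) ∧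
      ∃ ε : ℝ, 0 < ε ∧
        ∀ᶠ ℓ : ℕ in Filter.atTop,
          (p ^ (-(1 / 2) : ℝ) + ε) ^ ℓ ≤ (ramseyNumber ℓ ⌊C * (ℓ : ℝ)⌋₊ : ℝ) := by
  obtain ⟨p, hp, hbal, huniq, hgap⟩ := RamseyLower.exists_balanced_density hC
  obtain ⟨ω, hω, hev⟩ := RamseyLower.exists_not_ramseyProperty hC hp hbal hgap
  refine ⟨p, ⟨hp, (RamseyLower.eq_log_div_log_iff hp.1 hp.2).2 hbal⟩, fun q hq h =>
    huniq q hq ((RamseyLower.eq_log_div_log_iff hq.1 hq.2).1 h),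
    Real.exp (-(Real.log p / 2) + ω) - p ^ (-(1 / 2) : ℝ), ?_, ?_⟩
  · rw [Real.rpow_def_of_pos hp.1, sub_pos]
    exact Real.exp_lt_exp.2 (by linarith)
  · filter_upwards [hev] with ℓ hℓ
    rw [add_sub_cancel, ← Real.exp_nat_mul]
    refine (Nat.lt_floor_add_one _).le.trans ?_
    exact_mod_cast RamseyLower.lt_ramseyNumber hℓ
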